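/- Let $k$ be a non-Archimedean field: a field complete for a multiplicative ultrametric norm, the trivial norm being allowed. Put $k^\circ=\{a\in k:|a|\le 1\}$. Let $X$ be a variety over $k$, that is, a separated integral scheme of finite type over $k$. Let $x\in X^{\rm an}$ be a valuation, that is, a non-Archimedean absolute value on the function field $K(X)$ which extends the one of $k$. Let $\mathscr H(x)$ be the completion of $K(X)$ with respect to $x$, $\mathscr H(x)^\circ$ its valuation ring, and $\widetilde{\mathscr H(x)}$ the residue field of $\mathscr H(x)^\circ$ (the double residue field of $x$). A model of $X$ is a flat integral separated $k^\circ$-scheme $\mathcal X$ of finite type together with an isomorphism $\mathcal X\times_{\operatorname{Spec}k^\circ}\operatorname{Spec}k\cong X$ over $k$. A blow-up of $X$ is the blow-up of $X$ along a nonzero ideal sheaf of finite type. If $\mathcal X$ is a model or a blow-up of $X$, then $K(\mathcal X)=K(X)$, which gives a morphism $\operatorname{Spec}\mathscr H(x)\to\mathcal X$. One says that $x$ has a center in $\mathcal X$ if this morphism extends to a (necessarily unique) morphism $\operatorname{Spec}\mathscr H(x)^\circ\to\mathcal X$; the center $c_{\mathcal X}(x)$ is the image of the closed point, and there is a canonical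 inclusion $\kappa(c_{\mathcal X}(x))\hookrightarrow\widetilde{\mathscr H(x)}$. Let $B(X,x)$ be the set of all blow-ups of $X$ in which $x$ has a center if $k=k^\circ$ (i.e. $k$ is trivially valued), and of all models of $X$ in which $x$ has a center if $k\ne k^\circ$. Suppose that $B(X,x)\neq\emptyset$. Then 1. $\widetilde{\mathscr H(x)}=\bigcup_{\mathcal X\in B(X,x)}\kappa(c_{\mathcal X}(x))$. 2. For all $\mathcal X,\mathcal X'\in B(X,x)$ there is an $\mathcal X''\in B(X,x)$ which is a blow-up of $\mathcal X$ along a nonzero ideal sheaf of finite type, compatibly with the morphisms from $\operatorname{Spec}\mathscr H(x)^\circ$, such that $\kappa(c_{\mathcal X}(x))\subseteq\kappa(c_{\mathcal X''}(x))$ and $\kappa(c_{\mathcal X'}(x))\subseteq\kappa(c_{\mathcal X''}(x))$ in $\widetilde{\mathscr H(x)}$. 3. $\widetilde{\mathscr H(x)}=\varinjlim_{\mathcal X\in B(X,x)}\kappa(c_{\mathcal X}(x))$: the canonical homomorphism from the direct limit is an isomorphism. Here $B(X,x)$ is preordered by $\mathcal X\le\mathcal X'$ if $\kappa(c_{\mathcal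 X}(x))\subseteq\kappa(c_{\mathcal X'}(x))$ in $\widetilde{\mathscr H(x)}$, and the transition maps are these inclusions. -/

import Mathlib

open CategoryTheory AlgebraicGeometry

universe u

noncomputable section

namespace BerkovichCenter

/-! ### Rings of integers and completions -/

/-- The valuation ring `K° = {a | ‖a‖ ≤ 1}` of an ultrametric normed field. -/
abbrev integers (K : Type u) [NormedField K] [IsUltrametricDist K] : ValuationSubring K :=
  (NormedField.valuation (K := K)).valuationSubring

/-- The residue field `K° / K°°` of an ultrametric normed field. -/
abbrev reduction (K : Type u) [NormedField K] [IsUltrametricDist K] : Type u :=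
  IsLocalRing.ResidueField (integers K)

/-- `Spec K ⟶ Spec K°`. -/
abbrev specToIntegers (K : Type u) [NormedField K] [IsUltrametricDist K] :
    Spec (.of K) ⟶ Spec (.of (integers K)) :=
  Spec.map (CommRingCat.ofHom (integers K).subtype)

/-- The completion of a field for a non-Archimedean absolute value is ultrametric. -/
theorem isUltrametricDist_completion {K : Type u} [Field K] (v : AbsoluteValue K ℝ)
    (hv : IsNonarchimedean v) : IsUltrametricDist v.Completion := by
  refine IsUltrametricDist.isUltrametricDist_of_forall_norm_add_le_max_norm fun a b => ?_
  induction a, b using UniformSpace.Completion.induction_on₂ with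
  | hp => exact isClosed_le (by fun_prop) (by fun_prop)
  | ih a b =>
    rw [← UniformSpace.Completion.coe_add]
    simp only [UniformSpace.Completion.norm_coe]
    exact hv _ _

/-! ### Varieties and the analytification -/

/-- A variety over `k`: a separated integral scheme of finite type over `k`. -/
structure IsVariety {k : Type u} [Field k] {X : Scheme.{u}} (s : X ⟶ Spec (.of k)) : Prop where
  isIntegral : IsIntegral X
  isSeparated : IsSeparated s
  locallyOfFiniteType : LocallyOfFiniteType s
  quasiCompact : QuasiCompact s

/-- The structure homomorphism `k → κ(p)` at a point `p` of a `k`-scheme. -/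
def toResidueField {k : Type u} [Field k] {X : Scheme.{u}} (s : X ⟶ Spec (.of k)) (p : X) :
    k →+* X.residueField p :=
  (Spec.preimage (X.fromSpecResidueField p ≫ s)).hom

/-- A point of the Berkovich analytification `X^an` of a `k`-scheme `X` locally of finite type:
a point `pt = π_X(x)` of `X` together with a non-Archimedean absolute value on `κ(pt)` which
extends the absolute value of `k`.  (On an affine open `Spec A` that contains `pt` this is the
same as a multiplicative seminorm on `A` which extends the absolute value of `k`;
`pt` is the kernel of the seminorm.) -/
structure AnPoint {k : Type u} [NormedField k] {X : Scheme.{u}} (s : X ⟶ Spec (.of k)) where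
  pt : X
  abv : AbsoluteValue (X.residueField pt) ℝ
  nonarch : IsNonarchimedean abv
  extends_norm : ∀ a : k, abv (toResidueField s pt a) = ‖a‖

section Point

variable {k : Type u} [NormedField k] {X : Scheme.{u}} {s : X ⟶ Spec (.of k)}

/-- `x ∈ X^an` is a valuation (`x ∈ X^val`): `π_X(x)` is the generic point of `X`, that is, `x` is
an absolute value on the function field `K(X)`. -/
def AnPoint.IsValuation (x : AnPoint s) : Prop :=
  IsGenericPoint x.pt (Set.univ : Set X)

/-- `ℋ(x)`, the completion of `κ(π_X(x))` with respect to `x`. -/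
abbrev AnPoint.complField (x : AnPoint s) : Type u := x.abv.Completion

instance (x : AnPoint s) : IsUltrametricDist x.complField :=
  isUltrametricDist_completion x.abv x.nonarch

/-- The double residue field of `x`: the residue field of `ℋ(x)`. -/
abbrev AnPoint.doubleResidueField (x : AnPoint s) : Type u := reduction x.complField

/-- `κ(π_X(x)) → ℋ(x)`. -/
def AnPoint.toComplField (x : AnPoint s) : X.residueField x.pt →+* x.complField :=
  (UniformSpace.Completion.coeRingHom (α := WithAbs x.abv)).comp
    (WithAbs.equiv x.abv).symm.toRingHom

/-- The canonical morphism `Spec ℋ(x) ⟶ Spec κ(π_X(x)) ⟶ X`. -/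
def AnPoint.spec (x : AnPoint s) : Spec (.of x.complField) ⟶ X :=
  Spec.map (CommRingCat.ofHom x.toComplField) ≫ X.fromSpecResidueField x.pt

end Point

/-! ### Models and blow-ups -/

/-- A model of the `k`-scheme `X`: a flat integral separated scheme of finite type over `k°`
with an identification of its generic fibre with `X`, given as a cartesian square. -/
structure Model {k : Type u} [NormedField k] [IsUltrametricDist k] {X : Scheme.{u}}
    (s : X ⟶ Spec (.of k)) where
  scheme : Scheme.{u}
  str : scheme ⟶ Spec (.of (integers k))
  incl : X ⟶ scheme
  isPullback : IsPullback incl s str (specToIntegers k)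
  isIntegral : IsIntegral scheme
  flat : Flat str
  isSeparated : IsSeparated str
  locallyOfFiniteType : LocallyOfFiniteType str
  quasiCompact : QuasiCompact str

/-- The ideal sheaf `I` is invertible: locally generated by one non-zero-divisor. -/
def IsInvertible {Y : Scheme.{u}} (I : Y.IdealSheafData) : Prop :=
  ∀ y : Y, ∃ U : Y.affineOpens, y ∈ U.1 ∧
    ∃ f ∈ nonZeroDivisors Γ(Y, U.1), I.ideal U = Ideal.span {f}

/-- The ideal sheaf `I` is of finite type. -/
def IsFiniteType {Y : Scheme.{u}} (I : Y.IdealSheafData) : Prop :=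
  ∀ U : Y.affineOpens, (I.ideal U).FG

/-- `π : Y ⟶ X` is the blow-up of `X` along `I`: the inverse image ideal sheaf `I · 𝒪_Y` is
invertible, and `π` is universal among morphisms to `X` with this property. -/
structure IsBlowUp {X Y : Scheme.{u}} (π : Y ⟶ X) (I : X.IdealSheafData) : Prop where
  invertible : IsInvertible (I.comap π)
  universal : ∀ {T : Scheme.{u}} (f : T ⟶ X), IsInvertible (I.comap f) →
    ∃! g : T ⟶ Y, g ≫ π = f

/-- A blow-up of the integral scheme `X` along a nonzero ideal sheaf of finite type. -/
structure BlowUp (X : Scheme.{u}) where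
  scheme : Scheme.{u}
  proj : scheme ⟶ X
  ideal : X.IdealSheafData
  ne_bot : ideal ≠ ⊥
  isFiniteType : IsFiniteType ideal
  isBlowUp : IsBlowUp proj ideal

/-! ### Centers and the set `B(X, x)` -/

section Centered

variable {k : Type u} [NormedField k] [IsUltrametricDist k] {X : Scheme.{u}}
  {s : X ⟶ Spec (.of k)}

/-- `B(X, x)`: the blow-ups of `X` in which `x` has a center, if `k° = k`, and the models of `X`
in which `x` has a center, if `k° ≠ k`.

That `x` has a center in `𝒳` means that `Spec ℋ(x) ⟶ 𝒳` extends to a morphism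
`φ : Spec ℋ(x)° ⟶ 𝒳`.  The extension is over `Spec k°` automatically, because `ℋ(x)° → ℋ(x)` is
injective, and it is unique, by the valuative criterion of separatedness; so recording `φ` adds
no choice.  For a blow-up `proj : Y ⟶ X` the valuation `x` is regarded as a valuation on
`K(Y) = K(X)`: the morphism `Spec ℋ(x) ⟶ Y` is the unique one which lies over
`Spec ℋ(x) ⟶ X`. -/
inductive B (x : AnPoint s) : Type (u + 1)
  | blowUp (triv : integers k = ⊤) (Y : BlowUp X)
      (φ : Spec (.of (integers x.complField)) ⟶ Y.scheme)
      (comm : specToIntegers x.complField ≫ φ ≫ Y.proj = x.spec) : B x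
  | model (nontriv : integers k ≠ ⊤) (M : Model s)
      (φ : Spec (.of (integers x.complField)) ⟶ M.scheme)
      (comm : specToIntegers x.complField ≫ φ = x.spec ≫ M.incl) : B x

namespace B

variable {x : AnPoint s}

/-- The underlying scheme `𝒳`. -/
def scheme : B x → Scheme.{u}
  | blowUp _ Y _ _ => Y.scheme
  | model _ M _ _ => M.scheme

/-- The morphism `Spec ℋ(x)° ⟶ 𝒳`. -/
def φ : (b : B x) → (Spec (.of (integers x.complField)) ⟶ b.scheme)
  | blowUp _ _ f _ => f
  | model _ _ f _ => f

/-- The center `c_𝒳(x)`: the image of the closed point of `Spec ℋ(x)°`. -/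
def center (b : B x) : b.scheme :=
  b.φ (IsLocalRing.closedPoint (integers x.complField))

/-- The residue field `κ(c_𝒳(x))` of the center. -/
abbrev centerField (b : B x) : Type u := b.scheme.residueField b.center

/-- The local homomorphism `𝒪_{𝒳, c_𝒳(x)} → ℋ(x)°`. -/
def stalkHom (b : B x) : b.scheme.presheaf.stalk b.center →+* integers x.complField :=
  (Scheme.stalkClosedPointTo b.φ).hom

/-- The canonical inclusion of `κ(c_𝒳(x))` into the double residue field, induced on residue
fields by the local homomorphism `𝒪_{𝒳, c_𝒳(x)} → ℋ(x)°`. -/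
def toDouble (b : B x) : b.centerField →+* x.doubleResidueField :=
  haveI : IsLocalHom b.stalkHom := Scheme.isLocalHom_stalkClosedPointTo' b.φ
  IsLocalRing.ResidueField.map b.stalkHom

/-- `𝒳 ≤ 𝒴` when `κ(c_𝒳(x)) ⊆ κ(c_𝒴(x))` inside the double residue field, that is, when the
inclusion of `κ(c_𝒳(x))` factors through the one of `κ(c_𝒴(x))`. -/
instance : Preorder (B x) where
  le b c := ∃ i : b.centerField →+* c.centerField, c.toDouble.comp i = b.toDouble
  le_refl b := ⟨RingHom.id _, RingHom.comp_id _⟩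
  le_trans _ _ _ := fun ⟨i, hi⟩ ⟨j, hj⟩ => ⟨j.comp i, by rw [← RingHom.comp_assoc, hj, hi]⟩

/-- The canonical inclusion `κ(c_𝒳(x)) → κ(c_𝒴(x))` for `𝒳 ≤ 𝒴`: the only homomorphism which is
compatible with the inclusions into the double residue field. -/
def trans (b c : B x) (h : b ≤ c) : b.centerField →+* c.centerField := h.choose

theorem toDouble_trans (b c : B x) (h : b ≤ c) (a : b.centerField) :
    c.toDouble (trans b c h a) = b.toDouble a :=
  congrArg (fun f : b.centerField →+* x.doubleResidueField => f a) h.choose_spec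

/-- `𝒴` is a blow-up of `𝒳` (along an ideal sheaf of finite type), by a morphism compatible with
`Spec ℋ(x)° ⟶ 𝒴` and `Spec ℋ(x)° ⟶ 𝒳`.  At the generic point this says that the morphism respects
the identifications of the function fields with `K(X)`, and at the closed point that it maps
`c_𝒴(x)` to `c_𝒳(x)`. -/
def IsBlowUpOf (c b : B x) : Prop :=
  ∃ (π : c.scheme ⟶ b.scheme) (I : b.scheme.IdealSheafData),
    I ≠ ⊥ ∧ IsFiniteType I ∧ IsBlowUp π I ∧ c.φ ≫ π = b.φ

/-- The canonical homomorphism from the direct limit of the fields `κ(c_𝒳(x))`, `𝒳 ∈ B(X, x)`, to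
the double residue field. -/
def fromLimit (x : AnPoint s) :
    Ring.DirectLimit (fun b : B x => b.centerField) (fun b c h => trans b c h) →+*
      x.doubleResidueField :=
  Ring.DirectLimit.lift _ _ _ (fun b => b.toDouble) toDouble_trans

end B

end Centered

end BerkovichCenter

end

/-!
# Residue fields of centers exhaust the double residue field

The field `K(X)` is dense in `ℋ(x)`, so every element `ζ` of the double residue field is the residue
of a fraction `g / h ∈ ℋ(x)°`, where `g` and `h` are regular functions on an affine neighbourhood of
the center in a given `𝒳 ∈ B(X, x)` (`AnPoint.exists_fraction`). The ideal `(g, h)` extends to an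
ideal sheaf of finite type on `𝒳` (`exists_isFiniteType_ideal_eq`). On the blow-up along this ideal
sheaf it is generated by one element, which at the center of `x` must be `h`, since `|g| ≤ |h|`.
Hence `g / h` is regular at the center there, and `ζ` lies in the residue field of the center
(`AnPoint.exists_ideal_mem_residueRange`). The center persists in a blow-up: over the valuation ring
`ℋ(x)°` a nonzero ideal of finite type is invertible, so that `Spec ℋ(x)° ⟶ 𝒳` lifts by the universal
property (`AnPoint.isInvertible_comap`).

It remains to see that the blow-up belongs to `B(X, x)`. If `k` is trivially valued, `𝒳` is a
blow-up of `X`; one blows up the inverse image of an ideal sheaf `J` of `X`, and blowing up first `I`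
and then the inverse image of `J` is the blow-up of `I J` (`IsBlowUp.comp`,
`B.exists_isBlowUpOf_blowUp`). If `k` is not trivially valued, a constant `ϖ ≠ 0` of `k°` with
`|ϖ| ≤ |h|` is added to the ideal `(g, h)`. This does not affect the argument above, and the ideal
becomes trivial on the generic fibre, so that its blow-up is again a model of `X`
(`B.exists_isBlowUpOf_model`); flatness over `k°` is the absence of torsion (`flat_of_isDominant`).

The blow-up of `𝒳` that is needed for two members `𝒳`, `𝒳'` of `B(X, x)` is found as follows. If
`k` is trivially valued, one blows up on `𝒳` the inverse image of the ideal sheaf of `X` that belongs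
to `𝒳'`; the result maps to `𝒳'`. If `𝒳` and `𝒳'` are models, the residue field of the center in `𝒳'`
is generated as a field by the image of `k°` and by finitely many residues
(`exists_finset_residueRange_le`), and one blow-up of `𝒳` realizes finitely many residues
(`B.exists_ideal_subset_residueRange`). The statement on the direct limit follows, because the
system is directed and consists of subfields of the double residue field.

All of this rests on the existence of the blow-up along an ideal sheaf of finite type, with its
universal property. It is glued from the `Proj` of Rees algebras (`isBlowUp_affineBlowUp`,
`exists_isBlowUp`).
-/

noncomputable section

namespace BerkovichCenter

open Limits TopologicalSpace

/-! ### Inverse images of ideal sheaves -/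

/-- For affine schemes the inverse image ideal sheaf is given by the extension of ideals; both are
left adjoint to the contraction of ideals. -/
theorem ideal_comap_of_isAffine {X Y : Scheme.{u}} [IsAffine X] [IsAffine Y] (f : X ⟶ Y)
    (I : Y.IdealSheafData) :
    (I.comap f).ideal ⟨⊤, isAffineOpen_top X⟩ =
      (I.ideal ⟨⊤, isAffineOpen_top Y⟩).map f.appTop.hom := by
  apply le_antisymm
  · set L := Scheme.IdealSheafData.ofIdealTop
      ((I.ideal ⟨⊤, isAffineOpen_top Y⟩).map f.appTop.hom) with hL
    have hLT : L.ideal ⟨⊤, isAffineOpen_top X⟩ =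
        (I.ideal ⟨⊤, isAffineOpen_top Y⟩).map f.appTop.hom := by
      simp [hL]
    rw [← hLT]
    have : I.comap f ≤ L := by
      rw [← Scheme.IdealSheafData.le_map_iff_comap_le]
      refine Scheme.IdealSheafData.le_of_isAffine ?_
      rw [Scheme.IdealSheafData.ideal_map L f ⟨⊤, isAffineOpen_top Y⟩ (isAffineOpen_top X)]
      refine (Ideal.le_comap_map (f := f.appTop.hom)).trans ?_
      exact Ideal.comap_mono hLT.ge
    exact this _
  · rw [Ideal.map_le_iff_le_comap]
    have := I.le_map_comap f ⟨⊤, isAffineOpen_top Y⟩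
    rwa [Scheme.IdealSheafData.ideal_map _ f ⟨⊤, isAffineOpen_top Y⟩ (isAffineOpen_top X)] at this

theorem ideal_comap_of_isOpenImmersion_of_le {X Y : Scheme.{u}} (f : X ⟶ Y) [IsOpenImmersion f]
    (I : Y.IdealSheafData) (U : Y.affineOpens) (V : X.affineOpens) (h : V.1 ≤ f ⁻¹ᵁ U.1) :
    (I.comap f).ideal V = (I.ideal U).map (f.appLE U.1 V.1 h).hom := by
  rw [Scheme.IdealSheafData.ideal_comap_of_isOpenImmersion]
  have hle : f ''ᵁ V.1 ≤ U.1 := (f.image_mono h).trans (f.image_preimage_le U.1)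
  rw [← I.map_ideal (U := ⟨f ''ᵁ V.1, V.2.image_of_isOpenImmersion f⟩) (V := U) hle]
  have : (f.appLE U.1 V.1 h) = Y.presheaf.map (homOfLE hle).op ≫ (f.appIso V.1).hom := by
    rw [Scheme.Hom.appIso_hom', Scheme.Hom.map_appLE]
  rw [this, CommRingCat.hom_comp, ← Ideal.map_map]
  exact (Ideal.map_comap_of_equiv (f.appIso V.1).commRingCatIsoToRingEquiv).symm

/-- The inverse image ideal sheaf is locally given by the extension of ideals. -/
theorem ideal_comap {X Y : Scheme.{u}} (f : X ⟶ Y)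
    (I : Y.IdealSheafData) (U : Y.affineOpens) (V : X.affineOpens) (h : V.1 ≤ f ⁻¹ᵁ U.1) :
    (I.comap f).ideal V = (I.ideal U).map (f.appLE U.1 V.1 h).hom := by
  have : IsAffine V.1 := V.2
  have : IsAffine U.1 := U.2
  have e₁ := ideal_comap_of_isOpenImmersion_of_le V.1.ι (I.comap f) V ⟨⊤, isAffineOpen_top _⟩
    (by simp)
  have e₂ := ideal_comap_of_isOpenImmersion_of_le U.1.ι I U ⟨⊤, isAffineOpen_top _⟩ (by simp)
  have e₃ := ideal_comap_of_isAffine (f.resLE U.1 V.1 h) (I.comap U.1.ι)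
  rw [← Scheme.IdealSheafData.comap_comp, Scheme.Hom.resLE_comp_ι,
    Scheme.IdealSheafData.comap_comp, e₁, e₂, Ideal.map_map, ← CommRingCat.hom_comp] at e₃
  have e₄ : U.1.ι.appLE U.1 ⊤ (by simp) ≫ (f.resLE U.1 V.1 h).appTop =
      f.appLE U.1 V.1 h ≫ V.1.ι.appLE V.1 ⊤ (by simp) := by
    have hT : (⊤ : V.1.toScheme.Opens) ≤ f.resLE U.1 V.1 h ⁻¹ᵁ ⊤ := fun _ _ ↦ trivial
    have h₁ : (f.resLE U.1 V.1 h).appTop = (f.resLE U.1 V.1 h).appLE ⊤ ⊤ hT :=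
      Scheme.Hom.app_eq_appLE _
    refine (congrArg (_ ≫ ·) h₁).trans ?_
    refine (Scheme.Hom.appLE_comp_appLE _ _ _ _ _ _ hT).trans ?_
    rw [Scheme.Hom.appLE_comp_appLE]
    simp only [Scheme.Hom.resLE_comp_ι]
  rw [e₄, CommRingCat.hom_comp, ← Ideal.map_map] at e₃
  have hb : Function.Bijective (V.1.ι.appLE V.1 ⊤ (by simp)).hom := by
    have : V.1.ι.appLE V.1 ⊤ (by simp) = V.1.topIso.inv := by
      rw [Scheme.Opens.ι_appLE, Scheme.Opens.topIso_inv]; rfl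
    rw [this]
    exact ConcreteCategory.bijective_of_isIso V.1.topIso.inv
  have := congrArg (Ideal.comap (V.1.ι.appLE V.1 ⊤ (by simp)).hom) e₃
  exact (Ideal.comap_map_of_bijective _ hb).symm.trans
    (this.trans (Ideal.comap_map_of_bijective _ hb))

/-! ### Ideal sheaves of finite type and invertible ideal sheaves -/

/-- Every point of an open subset of an affine open `U` has a basic open neighbourhood in it. -/
theorem exists_affineBasicOpen_le {X : Scheme.{u}} (U : X.affineOpens) (W : X.Opens) {x : X}
    (hU : x ∈ U.1) (hW : x ∈ W) :
    ∃ r : Γ(X, U.1), x ∈ (X.affineBasicOpen r).1 ∧ (X.affineBasicOpen r).1 ≤ W := by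
  obtain ⟨f, hf, hx⟩ := U.2.exists_basicOpen_le ⟨x, hW⟩ hU
  exact ⟨f, hx, hf⟩

theorem exists_affineOpens_le {X : Scheme.{u}} (W : X.Opens) {x : X} (hW : x ∈ W) :
    ∃ U : X.affineOpens, x ∈ U.1 ∧ U.1 ≤ W := by
  obtain ⟨_, ⟨U, hU, rfl⟩, hxU, hle⟩ :=
    X.isBasis_affineOpens.exists_subset_of_mem_open hW W.isOpen
  exact ⟨⟨U, hU⟩, hxU, hle⟩

theorem fg_of_isLocalization_span {R : Type u} [CommRing R] {I : Ideal R} (t : Set R)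
    (ht : Ideal.span t = ⊤) (H : ∀ g ∈ t, ∃ (S : Type u) (_ : CommRing S) (_ : Algebra R S),
      IsLocalization.Away g S ∧ (I.map (algebraMap R S)).FG) : I.FG := by
  refine Ideal.fg_of_localizationSpan t ht fun g ↦ ?_
  obtain ⟨S, _, _, _, h⟩ := H g.1 g.2
  let e := IsLocalization.algEquiv (Submonoid.powers g.1) S (Localization.Away g.1)
  have := h.map (e : S →+* Localization.Away g.1)
  rw [Ideal.map_map] at this
  convert this
  ext x
  simp

theorem ideal_fg_of_forall_exists {Y : Scheme.{u}} {I : Y.IdealSheafData} (U : Y.affineOpens)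
    (h : ∀ y ∈ U.1, ∃ V : Y.affineOpens, y ∈ V.1 ∧ (I.ideal V).FG) : (I.ideal U).FG := by
  have hfg' (V W : Y.affineOpens) (hVW : V ≤ W) (hW : (I.ideal W).FG) : (I.ideal V).FG := by
    rw [← I.map_ideal hVW]; exact hW.map _
  refine fg_of_isLocalization_span {f | (I.ideal (Y.affineBasicOpen f)).FG} ?_ fun g hg ↦
    ⟨Γ(Y, Y.basicOpen g), inferInstance,
      (Y.presheaf.map (homOfLE (Y.basicOpen_le g)).op).hom.toAlgebra, U.2.isLocalization_basicOpen g, ?_⟩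
  · rw [← U.2.self_le_iSup_basicOpen_iff]
    intro x hx
    obtain ⟨V, hxV, hV⟩ := h x hx
    obtain ⟨f, g, hfg, hxf⟩ := exists_basicOpen_le_affine_inter U.2 V.2 x ⟨hx, hxV⟩
    refine Opens.mem_iSup.mpr ⟨⟨f, ?_⟩, hxf⟩
    refine hfg' (Y.affineBasicOpen f) V (by
      change Y.basicOpen f ≤ V.1
      rw [hfg]; exact Y.basicOpen_le g) hV
  · rw [RingHom.algebraMap_toAlgebra]
    have := I.map_ideal_basicOpen U g
    rw [this]
    exact hg

/-- An ideal sheaf which is of finite type near every point is of finite type. -/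
theorem isFiniteType_of_forall_exists {Y : Scheme.{u}} {I : Y.IdealSheafData}
    (h : ∀ y : Y, ∃ U : Y.affineOpens, y ∈ U.1 ∧ (I.ideal U).FG) : IsFiniteType I :=
  fun U ↦ ideal_fg_of_forall_exists U fun y _ ↦ h y

theorem exists_affineOpens_comap {X Y : Scheme.{u}} (f : X ⟶ Y) (x : X) (W : X.Opens)
    (hW : x ∈ W) (W' : Y.Opens) (hW' : f x ∈ W') :
    ∃ (U : Y.affineOpens) (V : X.affineOpens), x ∈ V.1 ∧ V.1 ≤ f ⁻¹ᵁ U.1 ∧ V.1 ≤ W ∧ U.1 ≤ W' := by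
  obtain ⟨U, hxU, hU⟩ := exists_affineOpens_le W' hW'
  obtain ⟨V, hxV, hV⟩ := exists_affineOpens_le (f ⁻¹ᵁ U.1 ⊓ W) (x := x) ⟨hxU, hW⟩
  exact ⟨U, V, hxV, hV.trans inf_le_left, hV.trans inf_le_right, hU⟩

theorem IsFiniteType.comap {X Y : Scheme.{u}} {I : Y.IdealSheafData} (hI : IsFiniteType I)
    (f : X ⟶ Y) : IsFiniteType (I.comap f) := by
  refine isFiniteType_of_forall_exists fun x ↦ ?_
  obtain ⟨U, V, hx, hV, -⟩ := exists_affineOpens_comap f x ⊤ trivial ⊤ trivial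
  refine ⟨V, hx, ?_⟩
  rw [ideal_comap f I U V hV]
  exact (hI U).map _

theorem IsFiniteType.mul {Y : Scheme.{u}} {I J : Y.IdealSheafData} (hI : IsFiniteType I)
    (hJ : IsFiniteType J) : IsFiniteType (I * J) := fun U ↦ (hI U).mul (hJ U)

theorem IsFiniteType.sup {Y : Scheme.{u}} {I J : Y.IdealSheafData} (hI : IsFiniteType I)
    (hJ : IsFiniteType J) : IsFiniteType (I ⊔ J) := fun U ↦ Submodule.FG.sup (hI U) (hJ U)

/-- Ideal sheaves agree if they agree on a basis of affine opens. -/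
theorem idealSheaf_ext_of_forall_exists {Y : Scheme.{u}} {I J : Y.IdealSheafData}
    (h : ∀ y : Y, ∃ U : Y.affineOpens, y ∈ U.1 ∧ I.ideal U = J.ideal U) : I = J := by
  choose U hU h using h
  exact Scheme.IdealSheafData.ext_of_iSup_eq_top U
    (top_le_iff.mp fun y _ ↦ Opens.mem_iSup.mpr ⟨y, hU y⟩) h

theorem comap_mul {X Y : Scheme.{u}} (f : X ⟶ Y) (I J : Y.IdealSheafData) :
    (I * J).comap f = I.comap f * J.comap f := by
  refine idealSheaf_ext_of_forall_exists fun x ↦ ?_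
  obtain ⟨U, V, hx, hV, -⟩ := exists_affineOpens_comap f x ⊤ trivial ⊤ trivial
  refine ⟨V, hx, ?_⟩
  rw [Scheme.IdealSheafData.ideal_mul, Pi.mul_apply, ideal_comap f _ U V hV,
    ideal_comap f _ U V hV, ideal_comap f _ U V hV, Scheme.IdealSheafData.ideal_mul,
    Pi.mul_apply, Ideal.map_mul]

theorem map_basicOpen_mem_nonZeroDivisors {X : Scheme.{u}} (U : X.affineOpens) (r f : Γ(X, U.1))
    (hf : f ∈ nonZeroDivisors Γ(X, U.1)) :
    (X.presheaf.map (homOfLE (X.basicOpen_le r)).op).hom f ∈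
      nonZeroDivisors Γ(X, (X.affineBasicOpen r).1) := by
  let _ := (X.presheaf.map (homOfLE (X.basicOpen_le r)).op).hom.toAlgebra
  have := U.2.isLocalization_basicOpen r
  exact IsLocalization.nonZeroDivisors_le_comap (Submonoid.powers r) Γ(X, X.basicOpen r) hf

/-- An invertible ideal sheaf is principal on arbitrarily small affine neighbourhoods. -/
theorem IsInvertible.exists_le {Y : Scheme.{u}} {I : Y.IdealSheafData} (hI : IsInvertible I)
    {y : Y} {W : Y.Opens} (hy : y ∈ W) :
    ∃ U : Y.affineOpens, y ∈ U.1 ∧ U.1 ≤ W ∧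
      ∃ f ∈ nonZeroDivisors Γ(Y, U.1), I.ideal U = Ideal.span {f} := by
  obtain ⟨U, hyU, f, hf, hUf⟩ := hI y
  obtain ⟨r, hyr, hr⟩ := exists_affineBasicOpen_le U W hyU hy
  refine ⟨Y.affineBasicOpen r, hyr, hr, _, map_basicOpen_mem_nonZeroDivisors U r f hf, ?_⟩
  rw [← I.map_ideal_basicOpen U r, hUf, Ideal.map_span, Set.image_singleton]
  rfl

theorem exists_span_singleton_comap_iff {R S : Type u} [CommRing R] [CommRing S] (e : R ≃+* S)
    (I : Ideal S) : (∃ f ∈ nonZeroDivisors R, I.comap (e : R →+* S) = Ideal.span {f}) ↔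
      ∃ f ∈ nonZeroDivisors S, I = Ideal.span {f} := by
  constructor
  · rintro ⟨f, hf, h⟩
    refine ⟨e f, by rw [← MulEquivClass.map_nonZeroDivisors e]; exact ⟨f, hf, rfl⟩, ?_⟩
    rw [← Ideal.map_comap_of_surjective (e : R →+* S) e.surjective I, h, Ideal.map_span]
    simp
  · rintro ⟨f, hf, rfl⟩
    refine ⟨e.symm f, by
      rw [← MulEquivClass.map_nonZeroDivisors e.symm]; exact ⟨f, hf, rfl⟩, ?_⟩
    have := Ideal.map_symm (I := Ideal.span {f}) e
    rw [Ideal.map_span] at this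
    rw [Set.image_singleton] at this
    exact this.symm

theorem exists_span_singleton_comap_isOpenImmersion_iff {X Y : Scheme.{u}} (j : X ⟶ Y)
    [IsOpenImmersion j] (I : Y.IdealSheafData) (V : X.affineOpens) :
    (∃ f ∈ nonZeroDivisors Γ(X, V.1), (I.comap j).ideal V = Ideal.span {f}) ↔
      ∃ f ∈ nonZeroDivisors Γ(Y, j ''ᵁ V.1),
        I.ideal ⟨j ''ᵁ V.1, V.2.image_of_isOpenImmersion j⟩ = Ideal.span {f} := by
  rw [Scheme.IdealSheafData.ideal_comap_of_isOpenImmersion]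
  exact exists_span_singleton_comap_iff (j.appIso V.1).symm.commRingCatIsoToRingEquiv _

theorem IsInvertible.comap_of_isOpenImmersion {X Y : Scheme.{u}} {I : Y.IdealSheafData}
    (hI : IsInvertible I) (j : X ⟶ Y) [IsOpenImmersion j] : IsInvertible (I.comap j) := by
  intro x
  obtain ⟨U, hxU, hU, h⟩ := hI.exists_le (y := j x) (W := j.opensRange) ⟨x, rfl⟩
  have hjU : j ''ᵁ j ⁻¹ᵁ U.1 = U.1 := by
    rw [Scheme.Hom.image_preimage_eq_opensRange_inf, inf_eq_right.mpr hU]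
  -- `j` identifies `j⁻¹ U` with `U`, because `U` lies in the range of `j`
  refine ⟨⟨j ⁻¹ᵁ U.1, U.2.preimage_of_isOpenImmersion j hU⟩, hxU, ?_⟩
  rw [exists_span_singleton_comap_isOpenImmersion_iff]
  have key (W : Y.affineOpens) (hW : W = U) :
      ∃ f ∈ nonZeroDivisors Γ(Y, W.1), I.ideal W = Ideal.span {f} := by
    subst hW; exact h
  exact key ⟨j ''ᵁ j ⁻¹ᵁ U.1, _⟩ (Subtype.ext hjU)

theorem isInvertible_of_openCover {Y : Scheme.{u}} {I : Y.IdealSheafData} (𝒰 : Y.OpenCover)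
    (h : ∀ i, IsInvertible (I.comap (𝒰.f i))) : IsInvertible I := by
  intro y
  obtain ⟨i, x, hx⟩ := 𝒰.exists_eq y
  obtain ⟨V, hxV, hV⟩ := h i x
  rw [exists_span_singleton_comap_isOpenImmersion_iff] at hV
  exact ⟨⟨𝒰.f i ''ᵁ V.1, V.2.image_of_isOpenImmersion (𝒰.f i)⟩, ⟨x, hxV, hx⟩, hV⟩

/-! ### The Rees algebra -/

section

open Polynomial

section Rees

variable {A : Type u} [CommRing A] (I : Ideal A)

/-- The Rees algebra `⨁ Iⁿ tⁿ` of an ideal `I`. -/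
def Rees : Type u := reesAlgebra I

instance : CommRing (Rees I) := inferInstanceAs (CommRing (reesAlgebra I))

instance : Algebra A (Rees I) := inferInstanceAs (Algebra A (reesAlgebra I))

variable {I} in
/-- An element of the Rees algebra as a polynomial in `t`. -/
def Rees.toPoly : Rees I →ₐ[A] A[X] := (reesAlgebra I).val

variable {I} in
theorem Rees.ext {p q : Rees I} (h : p.toPoly = q.toPoly) : p = q := Subtype.ext h

variable {I} in
theorem Rees.coeff_mem (p : Rees I) (n : ℕ) : p.toPoly.coeff n ∈ I ^ n := p.2 n

/-- The grading of the Rees algebra `⨁ Iⁿ tⁿ` by the degree in `t`. -/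
def reesGrading (n : ℕ) : Submodule A (Rees I) where
  carrier := {p | ∀ m, m ≠ n → p.toPoly.coeff m = 0}
  add_mem' hp hq m hm := by simp [hp m hm, hq m hm]
  zero_mem' m _ := by simp
  smul_mem' c p hp m hm := by simp [hp m hm]

/-- The element `a tⁿ` of the Rees algebra, for `a ∈ Iⁿ`. -/
def reesMonomial (n : ℕ) (a : A) (ha : a ∈ I ^ n) : Rees I :=
  ⟨monomial n a, reesAlgebra.monomial_mem.mpr ha⟩

variable {I}

theorem toPoly_reesMonomial (n : ℕ) (a : A) (ha : a ∈ I ^ n) :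
    (reesMonomial I n a ha).toPoly = monomial n a := rfl

theorem reesMonomial_mem (n : ℕ) (a : A) (ha : a ∈ I ^ n) :
    reesMonomial I n a ha ∈ reesGrading I n := fun m hm ↦ by
  rw [toPoly_reesMonomial, coeff_monomial, if_neg hm.symm]

theorem eq_reesMonomial_of_mem {n : ℕ} {p : Rees I} (hp : p ∈ reesGrading I n) :
    p = reesMonomial I n (p.toPoly.coeff n) (p.coeff_mem n) := by
  refine Rees.ext (Polynomial.ext fun m ↦ ?_)
  rw [toPoly_reesMonomial, coeff_monomial]
  split_ifs with h
  · rw [h]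
  · exact hp m (Ne.symm h)

theorem reesMonomial_mul {m n : ℕ} {a b : A} (ha : a ∈ I ^ m) (hb : b ∈ I ^ n)
    (h : a * b ∈ I ^ (m + n)) :
    reesMonomial I m a ha * reesMonomial I n b hb = reesMonomial I (m + n) (a * b) h :=
  Rees.ext (monomial_mul_monomial ..)

theorem coeff_coeAddMonoidHom (x : DirectSum ℕ fun n ↦ reesGrading I n) (n : ℕ) :
    (DirectSum.coeAddMonoidHom (reesGrading I) x).toPoly.coeff n = (x n).1.toPoly.coeff n := by
  classical
  induction x using DirectSum.induction_on with
  | zero => simp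
  | of i x =>
    rw [DirectSum.coeAddMonoidHom_of]
    by_cases h : i = n
    · subst h; simp
    · rw [x.2 n (Ne.symm h), DirectSum.of_eq_of_ne _ _ _ (Ne.symm h)]; simp
  | add x y hx hy => simp [hx, hy]

theorem coeAddMonoidHom_reesGrading_bijective :
    Function.Bijective (DirectSum.coeAddMonoidHom (reesGrading I)) := by
  classical
  constructor
  · intro x y hxy
    refine DFinsupp.ext fun n ↦ Subtype.ext ?_
    have := congrArg (fun p : Rees I ↦ p.toPoly.coeff n) hxy
    simp only [coeff_coeAddMonoidHom] at this
    rw [eq_reesMonomial_of_mem (x n).2, eq_reesMonomial_of_mem (y n).2]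
    exact Rees.ext (congrArg (monomial n) this)
  · intro p
    refine ⟨∑ n ∈ p.toPoly.support, DirectSum.of (fun n ↦ reesGrading I n) n
      ⟨reesMonomial I n (p.toPoly.coeff n) (p.coeff_mem n), reesMonomial_mem _ _ _⟩, ?_⟩
    rw [map_sum]
    simp only [DirectSum.coeAddMonoidHom_of]
    refine Rees.ext ?_
    rw [map_sum]
    exact p.toPoly.as_sum_support.symm

instance : GradedAlgebra (reesGrading I) where
  one_mem m hm := by simp [coeff_one, hm]
  mul_mem m n p q hp hq := by
    change p * q ∈ reesGrading I (m + n)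
    rw [eq_reesMonomial_of_mem hp, eq_reesMonomial_of_mem hq,
      reesMonomial_mul _ _ (pow_add I m n ▸ Ideal.mul_mem_mul (p.coeff_mem m) (q.coeff_mem n))]
    exact reesMonomial_mem _ _ _
  __ := DirectSum.IsInternal.chooseDecomposition _ coeAddMonoidHom_reesGrading_bijective

variable (I) in
theorem algebraMap_reesGrading_zero_surjective :
    Function.Surjective (algebraMap A (reesGrading I 0)) := fun p ↦ by
  refine ⟨p.1.toPoly.coeff 0, Subtype.ext ?_⟩
  refine Eq.trans ?_ (eq_reesMonomial_of_mem p.2).symm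
  rfl

theorem reesMonomial_add {n : ℕ} {a b : A} (ha : a ∈ I ^ n) (hb : b ∈ I ^ n) :
    reesMonomial I n (a + b) (add_mem ha hb) = reesMonomial I n a ha + reesMonomial I n b hb :=
  Rees.ext (map_add (monomial n) a b)

theorem reesMonomial_mem_span {n : ℕ} (hn : n ≠ 0) {a : A} (ha : a ∈ I ^ n) :
    reesMonomial I n a ha ∈ Ideal.span
      (Set.range fun a : I ↦ reesMonomial I 1 a.1 (by simp)) := by
  obtain ⟨n, rfl⟩ := Nat.exists_eq_add_one_of_ne_zero hn
  have ha' := ha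
  rw [pow_succ] at ha'
  suffices ∃ h, reesMonomial I (n + 1) a h ∈ Ideal.span
      (Set.range fun a : I ↦ reesMonomial I 1 a.1 (by simp)) from this.2
  refine Submodule.smul_induction_on ha' (fun b hb c hc ↦ ?_) fun b c hb hc ↦ ?_
  · have h : b * c ∈ I ^ (n + 1) := by rw [pow_succ]; exact Ideal.mul_mem_mul hb hc
    have hc' : c ∈ I ^ 1 := by rwa [pow_one]
    rw [smul_eq_mul]
    refine ⟨h, ?_⟩
    rw [← reesMonomial_mul hb hc' h]
    exact Ideal.mul_mem_left _ _ (Ideal.subset_span ⟨⟨c, hc⟩, rfl⟩)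
  · obtain ⟨hb, hb'⟩ := hb
    obtain ⟨hc, hc'⟩ := hc
    refine ⟨add_mem hb hc, ?_⟩
    rw [reesMonomial_add hb hc]
    exact add_mem hb' hc'

/-- The irrelevant ideal of the Rees algebra is generated in degree one, so that the charts belonging
to elements of degree one cover its `Proj`. -/
theorem irrelevant_reesGrading_le :
    (HomogeneousIdeal.irrelevant (reesGrading I)).toIdeal ≤ Ideal.span
      (Set.range fun a : I ↦ reesMonomial I 1 a.1 (by simp)) := by
  classical
  intro p hp
  rw [← DirectSum.sum_support_decompose (reesGrading I) p]
  refine Ideal.sum_mem _ fun n _ ↦ ?_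
  by_cases hn : n = 0
  · subst hn
    have := (HomogeneousIdeal.mem_irrelevant_iff _ _).mp hp
    rw [GradedRing.proj_apply] at this
    rw [this]; exact zero_mem _
  · rw [eq_reesMonomial_of_mem (DirectSum.decompose (reesGrading I) p n).2]
    exact reesMonomial_mem_span hn _

theorem finiteType_rees (hI : I.FG) : Algebra.FiniteType (reesGrading I 0) (Rees I) := by
  have : Algebra.FiniteType A (Rees I) :=
    ⟨(reesAlgebra I).fg_top.mpr (reesAlgebra.fg hI)⟩
  have : IsScalarTower A (reesGrading I 0) (Rees I) :=
    ⟨fun a p q ↦ smul_mul_assoc a p.1 q⟩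
  exact Algebra.FiniteType.of_restrictScalars_finiteType A _ _

end Rees

end

/-! ### The charts of a blow-up -/

section

open Polynomial

section ReesAway

variable {A : Type u} [CommRing A] {I : Ideal A} {a : A} (ha : a ∈ I)

/-- The element `a t` of degree one of the Rees algebra, for `a ∈ I`. -/
def reesOne : Rees I := reesMonomial I 1 a (by rwa [pow_one])

theorem reesOne_mem : reesOne ha ∈ reesGrading I 1 := reesMonomial_mem _ _ _

theorem reesOne_pow (n : ℕ) :
    reesOne ha ^ n = reesMonomial I n (a ^ n) (Ideal.pow_mem_pow ha n) :=
  Rees.ext ((monomial_pow 1 a n).trans (by rw [one_mul]; rfl))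

/-- The coordinate ring `A[I/a]` of the chart of the blow-up where `a ∈ I` generates the
inverse image of `I`. -/
def ReesAway : Type u := HomogeneousLocalization.Away (reesGrading I) (reesOne ha)

instance : CommRing (ReesAway ha) :=
  inferInstanceAs (CommRing (HomogeneousLocalization.Away (reesGrading I) (reesOne ha)))

/-- The inclusion of `A[I/a]` into the localization of the Rees algebra. -/
def ReesAway.val : ReesAway ha →+* Localization.Away (reesOne ha) :=
  algebraMap (HomogeneousLocalization (reesGrading I) (.powers (reesOne ha)))
    (Localization (.powers (reesOne ha)))

theorem ReesAway.val_injective : Function.Injective (ReesAway.val ha) :=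
  HomogeneousLocalization.val_injective _

/-- The structure map `A → A[I/a]`. -/
def toReesAway : A →+* ReesAway ha :=
  (HomogeneousLocalization.fromZeroRingHom (reesGrading I) (.powers (reesOne ha))).comp
    (algebraMap A (reesGrading I 0))

theorem ReesAway.val_toReesAway (c : A) :
    ReesAway.val ha (toReesAway ha c) = algebraMap _ _ (algebraMap A (Rees I) c) := by
  rw [← Localization.mk_one_eq_algebraMap]
  rfl

/-- The fraction `c / aⁿ` in `A[I/a]`, for `c ∈ Iⁿ`. -/
def reesAwayMk (n : ℕ) (c : A) (hc : c ∈ I ^ n) : ReesAway ha :=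
  HomogeneousLocalization.Away.mk (reesGrading I) (reesOne_mem ha) n
    (reesMonomial I n c hc) (by simpa using reesMonomial_mem n c hc)

theorem ReesAway.val_reesAwayMk (n : ℕ) (c : A) (hc : c ∈ I ^ n) :
    ReesAway.val ha (reesAwayMk ha n c hc) =
      Localization.mk (reesMonomial I n c hc)
        ⟨reesOne ha ^ n, (⟨n, rfl⟩ : _ ∈ Submonoid.powers (reesOne ha))⟩ :=
  HomogeneousLocalization.Away.val_mk (reesGrading I) n (reesOne_mem ha) _ _

theorem reesAwayMk_surjective (z : ReesAway ha) : ∃ n c hc, reesAwayMk ha n c hc = z := by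
  obtain ⟨n, p, hp, rfl⟩ := HomogeneousLocalization.Away.mk_surjective (reesGrading I)
    (reesOne_mem ha) z
  have hp' : p ∈ reesGrading I n := by simpa using hp
  obtain ⟨c, hc, rfl⟩ : ∃ c hc, p = reesMonomial I n c hc := ⟨_, _, eq_reesMonomial_of_mem hp'⟩
  exact ⟨n, c, hc, rfl⟩

theorem toReesAway_pow_mul_reesAwayMk (n : ℕ) (c : A) (hc : c ∈ I ^ n) :
    toReesAway ha a ^ n * reesAwayMk ha n c hc = toReesAway ha c := by
  apply ReesAway.val_injective
  rw [map_mul, map_pow, ReesAway.val_toReesAway, ReesAway.val_toReesAway, ReesAway.val_reesAwayMk,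
    Localization.mk_eq_mk', ← map_pow, IsLocalization.mul_mk'_eq_mk'_of_mul,
    IsLocalization.mk'_eq_iff_eq_mul, ← map_mul]
  congr 1
  simp only [reesOne_pow]
  refine Rees.ext ?_
  change (algebraMap A A[X] a) ^ n * monomial n c = algebraMap A A[X] c * monomial n (a ^ n)
  simp only [algebraMap_eq, ← C_pow, C_mul_monomial, mul_comm]

/-- The exceptional divisor is a Cartier divisor on the chart `A[I/a]`: if `a · c / aⁿ = 0` then
`aᵐ⁺¹ c = 0` for some `m`. -/
theorem toReesAway_mem_nonZeroDivisors : toReesAway ha a ∈ nonZeroDivisors (ReesAway ha) := by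
  rw [mem_nonZeroDivisors_iff_left]
  intro z hz
  obtain ⟨n, c, hc, rfl⟩ := reesAwayMk_surjective ha z
  apply ReesAway.val_injective
  apply_fun ReesAway.val ha at hz
  rw [map_mul, ReesAway.val_toReesAway, ReesAway.val_reesAwayMk, Localization.mk_eq_mk',
    IsLocalization.mul_mk'_eq_mk'_of_mul, map_zero, IsLocalization.mk'_eq_zero_iff] at hz
  rw [ReesAway.val_reesAwayMk, Localization.mk_eq_mk', map_zero, IsLocalization.mk'_eq_zero_iff]
  obtain ⟨⟨_, m, rfl⟩, hm⟩ := hz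
  refine ⟨⟨_, m + 1, rfl⟩, ?_⟩
  simp only [reesOne_pow] at hm ⊢
  have hm' : monomial m (a ^ m) * (C a * monomial n c) = 0 := congrArg Rees.toPoly hm
  rw [C_mul_monomial, monomial_mul_monomial, monomial_eq_zero_iff] at hm'
  refine Rees.ext ?_
  change monomial (m + 1) (a ^ (m + 1)) * monomial n c = 0
  rw [monomial_mul_monomial, monomial_eq_zero_iff, pow_succ, mul_assoc, hm']

theorem toReesAway_mul_reesAwayMk_one {c : A} (hc : c ∈ I) :
    toReesAway ha a * reesAwayMk ha 1 c (by rwa [pow_one]) = toReesAway ha c := by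
  simpa using toReesAway_pow_mul_reesAwayMk ha 1 c (by rwa [pow_one])

/-- On the chart `A[I/a]`, the inverse image of `I` is generated by `a`. -/
theorem map_toReesAway : I.map (toReesAway ha) = Ideal.span {toReesAway ha a} := by
  apply le_antisymm
  · rw [Ideal.map_le_iff_le_comap]
    intro c hc
    rw [Ideal.mem_comap, Ideal.mem_span_singleton, ← toReesAway_mul_reesAwayMk_one ha hc]
    exact dvd_mul_right _ _
  · rw [Ideal.span_singleton_le_iff_mem]
    exact Ideal.mem_map_of_mem _ ha

/-- Homomorphisms out of `A[I/a]` are determined on `A` if `a` becomes a non-zero-divisor. -/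
theorem reesAway_hom_ext {R : Type u} [CommRing R] {f g : ReesAway ha →+* R}
    (h : f.comp (toReesAway ha) = g.comp (toReesAway ha))
    (hf : f (toReesAway ha a) ∈ nonZeroDivisors R) : f = g := by
  have h' (c : A) : f (toReesAway ha c) = g (toReesAway ha c) := RingHom.congr_fun h c
  ext z
  obtain ⟨n, c, hc, rfl⟩ := reesAwayMk_surjective ha z
  have e := toReesAway_pow_mul_reesAwayMk ha n c hc
  have e₁ := congrArg f e
  have e₂ := congrArg g e
  rw [map_mul, map_pow] at e₁ e₂
  rw [← h', ← h', ← e₁] at e₂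
  exact ((mul_cancel_left_mem_nonZeroDivisors (pow_mem hf n)).mp e₂).symm

end ReesAway

end

/-! ### The blow-up of an affine scheme -/

section

open Polynomial

theorem hom_ext_of_forall_exists {T Y : Scheme.{u}} {g g' : T ⟶ Y}
    (h : ∀ t : T, ∃ (W : Scheme.{u}) (j : W ⟶ T) (_ : IsOpenImmersion j),
      t ∈ Set.range j ∧ j ≫ g = j ≫ g') : g = g' := by
  choose W j hj ht h using h
  let 𝒰 : T.OpenCover :=
    { I₀ := T
      X := W
      f := j
      mem₀ := by
        rw [Scheme.presieve₀_mem_precoverage_iff]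
        exact ⟨fun x ↦ ⟨x, ht x⟩, fun x ↦ hj x⟩ }
  exact 𝒰.hom_ext _ _ h

/-- Lifts of a morphism `f : T ⟶ X` along `π : Y ⟶ X` glue if they exist locally and are unique
on all open subschemes of `T`. -/
theorem existsUnique_lift_of_local {T X Y : Scheme.{u}} (π : Y ⟶ X) (f : T ⟶ X)
    (hE : ∀ t : T, ∃ (W : Scheme.{u}) (j : W ⟶ T) (_ : IsOpenImmersion j) (g : W ⟶ Y),
      t ∈ Set.range j ∧ g ≫ π = j ≫ f)
    (hU : ∀ {W : Scheme.{u}} (j : W ⟶ T) [IsOpenImmersion j] (g g' : W ⟶ Y),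
      g ≫ π = j ≫ f → g' ≫ π = j ≫ f → g = g') : ∃! g : T ⟶ Y, g ≫ π = f := by
  choose W j hj g ht hg using hE
  let 𝒰 : T.OpenCover :=
    { I₀ := T
      X := W
      f := j
      mem₀ := by
        rw [Scheme.presieve₀_mem_precoverage_iff]
        exact ⟨fun x ↦ ⟨x, ht x⟩, fun x ↦ hj x⟩ }
  have hc (x y : T) : pullback.fst (j x) (j y) ≫ g x = pullback.snd (j x) (j y) ≫ g y := by
    refine hU (pullback.fst (j x) (j y) ≫ j x) _ _ (by simp [hg]) ?_
    rw [Category.assoc, hg, ← pullback.condition_assoc, Category.assoc]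
  refine ⟨𝒰.glueMorphisms g hc, ?_, fun g' hg' ↦ ?_⟩
  · refine 𝒰.hom_ext _ _ fun x ↦ ?_
    rw [← Category.assoc, 𝒰.ι_glueMorphisms]
    exact hg x
  · refine 𝒰.hom_ext _ _ fun x ↦ ?_
    rw [𝒰.ι_glueMorphisms]
    exact hU (j x) _ _ (by rw [Category.assoc, hg']) (hg x)

section Spec

variable {A R : Type u} [CommRing A] [CommRing R]

/-- The ideal sheaf on `Spec A` defined by an ideal of `A`. -/
def specIdeal (I : Ideal A) : (Spec (.of A)).IdealSheafData :=
  .ofIdealTop (I.map (Scheme.ΓSpecIso (.of A)).inv.hom)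

theorem specIdeal_ideal_top (I : Ideal A) :
    (specIdeal I).ideal ⟨⊤, isAffineOpen_top _⟩ = I.map (Scheme.ΓSpecIso (.of A)).inv.hom := by
  simp [specIdeal]

theorem comap_specIdeal (ρ : A →+* R) (I : Ideal A) :
    (specIdeal I).comap (Spec.map (CommRingCat.ofHom ρ)) = specIdeal (I.map ρ) := by
  refine Scheme.IdealSheafData.ext_of_isAffine ?_
  rw [ideal_comap_of_isAffine, specIdeal_ideal_top, specIdeal_ideal_top, Ideal.map_map,
    Ideal.map_map, ← CommRingCat.hom_comp, ← Scheme.ΓSpecIso_inv_naturality]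
  rfl

theorem isInvertible_specIdeal_span {f : A} (hf : f ∈ nonZeroDivisors A) :
    IsInvertible (specIdeal (Ideal.span {f})) := fun y ↦ by
  refine ⟨⟨⊤, isAffineOpen_top _⟩, trivial, (Scheme.ΓSpecIso (.of A)).inv.hom f, ?_, ?_⟩
  · change _ ∈ nonZeroDivisors Γ(Spec (.of A), ⊤)
    rw [← MulEquivClass.map_nonZeroDivisors
      (Scheme.ΓSpecIso (.of A)).symm.commRingCatIsoToRingEquiv]
    exact ⟨f, hf, rfl⟩
  · rw [specIdeal_ideal_top, Ideal.map_span, Set.image_singleton]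

theorem fromSpec_appLE_top {T : Scheme.{u}} (V : T.affineOpens) :
    V.2.fromSpec.appLE V.1 ⊤ V.2.fromSpec_preimage_self.ge = (Scheme.ΓSpecIso Γ(T, V.1)).inv := by
  rw [Scheme.Hom.appLE, V.2.fromSpec_app_self, Category.assoc, ← Functor.map_comp]
  exact (congrArg _ ((Spec Γ(T, V.1)).presheaf.map_id _)).trans (Category.comp_id _)

theorem comap_fromSpec {T : Scheme.{u}} (I : T.IdealSheafData) (V : T.affineOpens) :
    I.comap V.2.fromSpec = specIdeal (I.ideal V) := by
  refine Scheme.IdealSheafData.ext_of_isAffine ?_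
  rw [specIdeal_ideal_top, ideal_comap V.2.fromSpec I V ⟨⊤, isAffineOpen_top _⟩
    V.2.fromSpec_preimage_self.ge]
  rw [fromSpec_appLE_top]
  rfl

theorem specIdeal_injective : Function.Injective (specIdeal (A := A)) := fun I J h ↦ by
  have := congrArg (fun K ↦ (K.ideal ⟨⊤, isAffineOpen_top _⟩).comap
    (Scheme.ΓSpecIso (.of A)).inv.hom) h
  simp only [specIdeal_ideal_top] at this
  have hb : Function.Bijective (Scheme.ΓSpecIso (.of A)).inv.hom :=
    ConcreteCategory.bijective_of_isIso (Scheme.ΓSpecIso (.of A)).inv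
  rwa [Ideal.comap_map_of_bijective _ hb, Ideal.comap_map_of_bijective _ hb] at this

end Spec

section AffineBlowUp

variable {A : Type u} [CommRing A] (I : Ideal A)

/-- The blow-up of `Spec A` along `I`, as the `Proj` of the Rees algebra. -/
def affineBlowUp : Scheme.{u} := Proj (reesGrading I)

/-- The structure morphism of the blow-up of `Spec A` along `I`. -/
def affineBlowUpProj : affineBlowUp I ⟶ Spec (.of A) :=
  Proj.toSpecZero (reesGrading I) ≫ Spec.map (CommRingCat.ofHom (algebraMap A (reesGrading I 0)))

variable {I}

/-- The chart `Spec A[I/a]` of the blow-up of `Spec A` along `I`, for `a ∈ I`. -/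
def affineBlowUpChart {a : A} (ha : a ∈ I) : Spec (.of (ReesAway ha)) ⟶ affineBlowUp I :=
  Proj.awayι (reesGrading I) (reesOne ha) (reesOne_mem ha) one_pos

instance {a : A} (ha : a ∈ I) : IsOpenImmersion (affineBlowUpChart ha) :=
  inferInstanceAs (IsOpenImmersion (Proj.awayι ..))

theorem affineBlowUpChart_proj {a : A} (ha : a ∈ I) :
    affineBlowUpChart ha ≫ affineBlowUpProj I = Spec.map (CommRingCat.ofHom (toReesAway ha)) := by
  refine (Proj.awayι_toSpecZero_assoc (reesGrading I) _ (reesOne_mem ha) one_pos _).trans ?_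
  rw [← Spec.map_comp]
  rfl

theorem exists_mem_range_affineBlowUpChart (y : affineBlowUp I) :
    ∃ (a : A) (ha : a ∈ I), y ∈ Set.range (affineBlowUpChart ha) := by
  have h := Proj.iSup_basicOpen_eq_top (reesGrading I) (fun a : I ↦ reesOne a.2)
    irrelevant_reesGrading_le
  obtain ⟨a, ha⟩ := Opens.mem_iSup.mp (h.ge (Set.mem_univ y))
  refine ⟨a.1, a.2, ?_⟩
  rw [← Proj.opensRange_awayι (reesGrading I) (reesOne a.2) (reesOne_mem a.2) one_pos] at ha
  exact ha

/-- On each chart `Spec A[I/a]` the inverse image of `I` is generated by the non-zero-divisor `a`. -/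
theorem isInvertible_comap_affineBlowUpProj :
    IsInvertible ((specIdeal I).comap (affineBlowUpProj I)) := by
  choose a ha h using exists_mem_range_affineBlowUpChart (I := I)
  let 𝒰 : (affineBlowUp I).OpenCover :=
    { I₀ := affineBlowUp I
      X y := Spec (.of (ReesAway (ha y)))
      f y := affineBlowUpChart (ha y)
      mem₀ := by
        rw [Scheme.presieve₀_mem_precoverage_iff]
        exact ⟨fun x ↦ ⟨x, h x⟩, fun x ↦ inferInstance⟩ }
  refine isInvertible_of_openCover 𝒰 fun y ↦ ?_
  change IsInvertible (((specIdeal I).comap _).comap (affineBlowUpChart (ha y)))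
  rw [← Scheme.IdealSheafData.comap_comp, affineBlowUpChart_proj, comap_specIdeal,
    map_toReesAway]
  exact isInvertible_specIdeal_span (toReesAway_mem_nonZeroDivisors _)

instance : IsSeparated (affineBlowUpProj I) :=
  inferInstanceAs (IsSeparated (Proj.toSpecZero (reesGrading I) ≫
    Spec.map (CommRingCat.ofHom (algebraMap A (reesGrading I 0)))))

theorem affineBlowUpProj_locallyOfFiniteType (hI : I.FG) :
    LocallyOfFiniteType (affineBlowUpProj I) := by
  have := finiteType_rees hI
  have := IsClosedImmersion.spec_of_surjective
    (CommRingCat.ofHom (algebraMap A (reesGrading I 0)))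
    (algebraMap_reesGrading_zero_surjective I)
  exact inferInstanceAs (LocallyOfFiniteType (Proj.toSpecZero (reesGrading I) ≫
    Spec.map (CommRingCat.ofHom (algebraMap A (reesGrading I 0)))))

theorem affineBlowUpProj_quasiCompact (hI : I.FG) : QuasiCompact (affineBlowUpProj I) := by
  have := finiteType_rees hI
  exact inferInstanceAs (QuasiCompact (Proj.toSpecZero (reesGrading I) ≫
    Spec.map (CommRingCat.ofHom (algebraMap A (reesGrading I 0)))))

end AffineBlowUp

end

/-! ### The universal property of the blow-up of an affine scheme -/

section

open Polynomial

section AffineBlowUp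

variable {A R : Type u} [CommRing A] [CommRing R] {I : Ideal A}

/-- The homomorphism `a tⁿ ↦ ρ(a) / eⁿ` from the Rees algebra to the localization `R[1/e]`. -/
def reesToLocalization (ρ : A →+* R) (e : R) : Rees I →+* Localization.Away e :=
  (eval₂RingHom ((algebraMap R (Localization.Away e)).comp ρ)
    (IsLocalization.Away.invSelf e)).comp Rees.toPoly.toRingHom

theorem reesToLocalization_reesMonomial (ρ : A →+* R) (e : R) (n : ℕ) (a : A) (ha : a ∈ I ^ n) :
    algebraMap R _ e ^ n * reesToLocalization ρ e (reesMonomial I n a ha) =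
      algebraMap R (Localization.Away e) (ρ a) := by
  have : reesToLocalization ρ e (reesMonomial I n a ha) =
      algebraMap R (Localization.Away e) (ρ a) * IsLocalization.Away.invSelf e ^ n :=
    eval₂_monomial ..
  rw [this, mul_left_comm, ← mul_pow, IsLocalization.Away.mul_invSelf, one_pow, mul_one]

theorem algebraMap_away_injective {e : R} (he : e ∈ nonZeroDivisors R) :
    Function.Injective (algebraMap R (Localization.Away e)) :=
  IsLocalization.injective _ (Submonoid.powers_le.mpr he)

/-- If `e` generates `I R`, the fractions `ρ(a) / eⁿ` with `a ∈ Iⁿ` belong to `R`. -/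
theorem reesToLocalization_mem_range {ρ : A →+* R} {e : R}
    (h : I.map ρ = Ideal.span {e}) (p : Rees I) :
    reesToLocalization ρ e p ∈ (algebraMap R (Localization.Away e)).range := by
  classical
  have key (n : ℕ) (c : A) (hc : c ∈ I ^ n) : reesToLocalization ρ e (reesMonomial I n c hc) ∈
      (algebraMap R (Localization.Away e)).range := by
    have : ρ c ∈ Ideal.span {e ^ n} := by
      rw [← Ideal.span_singleton_pow, ← h, ← Ideal.map_pow]
      exact Ideal.mem_map_of_mem _ hc
    obtain ⟨d, hd⟩ := Ideal.mem_span_singleton.mp this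
    refine ⟨d, ?_⟩
    have hu : IsUnit (algebraMap R (Localization.Away e) e) :=
      IsLocalization.Away.algebraMap_isUnit e
    refine (hu.pow n).mul_left_cancel ?_
    rw [reesToLocalization_reesMonomial, hd, map_mul, map_pow]
  rw [← DirectSum.sum_support_decompose (reesGrading I) p, map_sum]
  refine sum_mem fun n _ ↦ ?_
  rw [eq_reesMonomial_of_mem (DirectSum.decompose (reesGrading I) p n).2]
  exact key _ _ _

/-- If `I` becomes principal with a generator `e` which is a non-zero-divisor, the Rees algebra
maps to `R` by `a tⁿ ↦ ρ(a) / eⁿ`. -/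
theorem exists_rees_hom {ρ : A →+* R} {e : R} (he : e ∈ nonZeroDivisors R)
    (h : I.map ρ = Ideal.span {e}) : ∃ θ : Rees I →+* R,
      ∀ n a ha, e ^ n * θ (reesMonomial I n a ha) = ρ a := by
  have hinj := algebraMap_away_injective he
  let ι : R ≃+* (algebraMap R (Localization.Away e)).range :=
    RingEquiv.ofBijective (algebraMap R (Localization.Away e)).rangeRestrict
      ⟨fun x y hxy ↦ hinj (congrArg Subtype.val hxy), RingHom.rangeRestrict_surjective _⟩
  have hι (x) : algebraMap R (Localization.Away e) (ι.symm x) = x.1 :=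
    congrArg Subtype.val (ι.apply_symm_apply x)
  refine ⟨(ι.symm : _ →+* R).comp ((reesToLocalization ρ e).codRestrict _
    (reesToLocalization_mem_range h)), fun n a ha ↦ hinj ?_⟩
  rw [map_mul, map_pow]
  refine (congrArg (_ * ·) (hι _)).trans ?_
  exact reesToLocalization_reesMonomial ρ e n a ha

/-- The existence part of the universal property of the blow-up, for morphisms from an affine scheme
on which the inverse image of `I` is principal. -/
theorem exists_lift_affineBlowUp {ρ : A →+* R} {e : R} (he : e ∈ nonZeroDivisors R)
    (h : I.map ρ = Ideal.span {e}) :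
    ∃ g : Spec (.of R) ⟶ affineBlowUp I, g ≫ affineBlowUpProj I =
      Spec.map (CommRingCat.ofHom ρ) := by
  obtain ⟨θ, hθ⟩ := exists_rees_hom he h
  -- `e R = I R` is contained in `e · θ(I t)`, and `e` can be cancelled
  have key : (HomogeneousIdeal.irrelevant (reesGrading I)).toIdeal.map θ = ⊤ := by
    rw [Ideal.eq_top_iff_one]
    have he' : e ∈ I.map ρ := h ▸ Ideal.mem_span_singleton_self e
    have hle : I.map ρ ≤ Ideal.span {e} *
        (HomogeneousIdeal.irrelevant (reesGrading I)).toIdeal.map θ := by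
      rw [Ideal.map_le_iff_le_comap]
      intro a ha
      have ha' : a ∈ I ^ 1 := by rwa [pow_one]
      rw [Ideal.mem_comap, ← hθ 1 a ha', pow_one]
      refine Ideal.mul_mem_mul (Ideal.mem_span_singleton_self e) (Ideal.mem_map_of_mem _ ?_)
      refine (HomogeneousIdeal.mem_irrelevant_iff _ _).mpr ?_
      rw [GradedRing.proj_apply,
        DirectSum.decompose_of_mem_ne _ (reesMonomial_mem 1 a ha') one_ne_zero]
    obtain ⟨z, hz, hez⟩ := Ideal.mem_span_singleton_mul.mp (hle he')
    have : z = 1 := by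
      refine (mul_cancel_left_mem_nonZeroDivisors he).mp ?_
      rw [hez, mul_one]
    rwa [← this]
  let σ := (Scheme.ΓSpecIso (.of R)).inv.hom
  have key' : (HomogeneousIdeal.irrelevant (reesGrading I)).toIdeal.map (σ.comp θ) = ⊤ := by
    rw [← Ideal.map_map, key, Ideal.map_top]
  refine ⟨Proj.fromOfGlobalSections (reesGrading I) (σ.comp θ) key', ?_⟩
  refine (Proj.fromOfGlobalSections_toSpecZero_assoc _ _ _ _).trans ?_
  rw [← Spec.map_comp, ← CommRingCat.ofHom_comp]
  have : (((σ.comp θ).comp (algebraMap (reesGrading I 0) (Rees I))).comp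
      (algebraMap A (reesGrading I 0))) = σ.comp ρ := by
    ext a
    have := hθ 0 a (by simp)
    rw [pow_zero, one_mul] at this
    exact congrArg σ this
  rw [this, CommRingCat.ofHom_comp, Spec.map_comp]
  have : (Spec (.of R)).toSpecΓ ≫ Spec.map (Scheme.ΓSpecIso (.of R)).inv = 𝟙 _ := by
    simp
  refine (Category.assoc _ _ _).symm.trans ?_
  exact (congrArg (· ≫ Spec.map (CommRingCat.ofHom ρ)) this).trans (Category.id_comp _)

/-- A morphism to the blow-up of `Spec A` that maps into two charts `Spec A[I/a]` and
`Spec A[I/b]` is determined by the composite with the projection. -/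
theorem affineBlowUpChart_hom_ext {a b : A} {ha : a ∈ I} {hb : b ∈ I} {ρ : A →+* R}
    {α : ReesAway ha →+* R} {β : ReesAway hb →+* R} (hα : α.comp (toReesAway ha) = ρ)
    (hβ : β.comp (toReesAway hb) = ρ) {e : R} (he : e ∈ nonZeroDivisors R)
    (h : I.map ρ = Ideal.span {e}) :
    Spec.map (CommRingCat.ofHom α) ≫ affineBlowUpChart ha =
      Spec.map (CommRingCat.ofHom β) ≫ affineBlowUpChart hb := by
  have hα' (c : A) : α (toReesAway ha c) = ρ c := RingHom.congr_fun hα c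
  have hβ' (c : A) : β (toReesAway hb c) = ρ c := RingHom.congr_fun hβ c
  have hea : ρ a ∈ nonZeroDivisors R := by
    have h₁ : Ideal.span {ρ a} = Ideal.span {e} := by
      rw [← h, ← hα, ← Ideal.map_map, map_toReesAway, Ideal.map_span, Set.image_singleton]
      rfl
    obtain ⟨u, hu⟩ := Ideal.mem_span_singleton.mp (h₁ ▸ Ideal.mem_span_singleton_self e)
    rw [hu] at he
    exact (mul_mem_nonZeroDivisors.mp he).1
  -- `b / a` and `a / b` exist in `R` and are inverse to each other, so that the morphism into the
  -- chart of `b` maps into the intersection of the charts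
  set y := α (reesAwayMk ha 1 b (by rwa [pow_one])) with hy
  set y' := β (reesAwayMk hb 1 a (by rwa [pow_one])) with hy'
  have h₁ : ρ a * y = ρ b := by
    rw [← hα', hy, ← map_mul, toReesAway_mul_reesAwayMk_one ha hb, hα']
  have h₂ : ρ b * y' = ρ a := by
    rw [← hβ', hy', ← map_mul, toReesAway_mul_reesAwayMk_one hb ha, hβ']
  have hu : y' * y = 1 := by
    refine (mul_cancel_left_mem_nonZeroDivisors hea).mp ?_
    rw [mul_one, mul_left_comm, h₁, mul_comm, h₂]
  have hr : Set.range (Spec.map (CommRingCat.ofHom β) ≫ affineBlowUpChart hb) ⊆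
      Set.range (affineBlowUpChart ha) := by
    rintro _ ⟨p, rfl⟩
    have e₁ : Set.range (affineBlowUpChart ha) =
        ((Proj.basicOpen (reesGrading I) (reesOne ha)).1 : Set (affineBlowUp I)) :=
      congrArg Opens.carrier
        (Proj.opensRange_awayι (reesGrading I) (reesOne ha) (reesOne_mem ha) one_pos)
    rw [e₁, Scheme.Hom.comp_apply]
    have e₂ := Proj.awayι_preimage_basicOpen (reesGrading I) (reesOne_mem hb) one_pos
      (reesOne_mem ha) one_pos
    refine (SetLike.ext_iff.mp e₂ _).mpr ?_
    intro hp
    refine p.2.ne_top ((Ideal.eq_top_iff_one _).mpr ?_)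
    rw [← hu]
    refine Ideal.mul_mem_right _ _ ?_
    convert (show β _ ∈ p.asIdeal from hp) using 1
    rw [hy']
    congr 1
    apply ReesAway.val_injective
    rw [ReesAway.val_reesAwayMk]
    refine Eq.trans ?_ (HomogeneousLocalization.Away.val_mk (reesGrading I) 1
      (reesOne_mem hb) _ _).symm
    congr 1
    exact (pow_one _).symm
  obtain ⟨γ, hγ⟩ := Spec.map_surjective (IsOpenImmersion.lift (affineBlowUpChart ha) _ hr)
  have hγ' : Spec.map γ ≫ affineBlowUpChart ha =
      Spec.map (CommRingCat.ofHom β) ≫ affineBlowUpChart hb := by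
    rw [hγ, IsOpenImmersion.lift_fac]
  have hγρ : γ.hom.comp (toReesAway ha) = ρ := by
    have := congrArg (· ≫ affineBlowUpProj I) hγ'
    simp only [Category.assoc, affineBlowUpChart_proj, ← Spec.map_comp] at this
    have := congrArg CommRingCat.Hom.hom (Spec.map_injective this)
    exact this.trans hβ
  have : α = γ.hom := reesAway_hom_ext ha (hα.trans hγρ.symm) (by rwa [hα'])
  rw [← hγ', this]
  rfl

/-- The morphism to `Spec A` given on an affine open by `ρ`. -/
theorem exists_hom_fromSpec_comp {T : Scheme.{u}} (f : T ⟶ Spec (.of A)) (V : T.affineOpens) :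
    ∃ ρ : A →+* Γ(T, V.1), V.2.fromSpec ≫ f = Spec.map (CommRingCat.ofHom ρ) ∧
      ((specIdeal I).comap f).ideal V = I.map ρ := by
  obtain ⟨ρ, hρ⟩ := Spec.map_surjective (V.2.fromSpec ≫ f)
  refine ⟨ρ.hom, hρ.symm, specIdeal_injective ?_⟩
  have := comap_specIdeal ρ.hom I
  rw [CommRingCat.ofHom_hom, hρ, Scheme.IdealSheafData.comap_comp, comap_fromSpec] at this
  exact this

/-- The uniqueness part of the universal property of the blow-up of an affine scheme. -/
theorem affineBlowUp_lift_unique {T : Scheme.{u}} {f : T ⟶ Spec (.of A)}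
    (hf : IsInvertible ((specIdeal I).comap f)) {g g' : T ⟶ affineBlowUp I}
    (hg : g ≫ affineBlowUpProj I = f) (hg' : g' ≫ affineBlowUpProj I = f) : g = g' := by
  refine hom_ext_of_forall_exists fun t ↦ ?_
  obtain ⟨a, ha, hga⟩ := exists_mem_range_affineBlowUpChart (g t)
  obtain ⟨b, hb, hgb⟩ := exists_mem_range_affineBlowUpChart (g' t)
  obtain ⟨V, htV, hV, e, he, hVe⟩ := hf.exists_le (y := t)
    (W := g ⁻¹ᵁ (affineBlowUpChart ha).opensRange ⊓ g' ⁻¹ᵁ (affineBlowUpChart hb).opensRange)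
    ⟨hga, hgb⟩
  refine ⟨_, V.2.fromSpec, V.2.isOpenImmersion_fromSpec, by rw [V.2.range_fromSpec]; exact htV, ?_⟩
  obtain ⟨ρ, hρ, hI⟩ := exists_hom_fromSpec_comp (I := I) f V
  rw [hI] at hVe
  have lift {c : A} (hc : c ∈ I) (g : T ⟶ affineBlowUp I) (hg : g ≫ affineBlowUpProj I = f)
      (hV : V.1 ≤ g ⁻¹ᵁ (affineBlowUpChart hc).opensRange) :
      ∃ α : ReesAway hc →+* Γ(T, V.1), α.comp (toReesAway hc) = ρ ∧
        Spec.map (CommRingCat.ofHom α) ≫ affineBlowUpChart hc = V.2.fromSpec ≫ g := by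
    have hr : Set.range (V.2.fromSpec ≫ g) ⊆ Set.range (affineBlowUpChart hc) := by
      rintro _ ⟨p, rfl⟩
      rw [Scheme.Hom.comp_apply]
      exact hV (V.2.range_fromSpec.le ⟨p, rfl⟩)
    obtain ⟨α, hα⟩ := Spec.map_surjective (IsOpenImmersion.lift (affineBlowUpChart hc) _ hr)
    have hα' : Spec.map α ≫ affineBlowUpChart hc = V.2.fromSpec ≫ g := by
      rw [hα, IsOpenImmersion.lift_fac]
    refine ⟨α.hom, ?_, hα'⟩
    have := congrArg (· ≫ affineBlowUpProj I) hα'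
    simp only [Category.assoc, affineBlowUpChart_proj, ← Spec.map_comp, hg, hρ] at this
    exact congrArg CommRingCat.Hom.hom (Spec.map_injective this)
  obtain ⟨α, hα, hα'⟩ := lift ha g hg (hV.trans inf_le_left)
  obtain ⟨β, hβ, hβ'⟩ := lift hb g' hg' (hV.trans inf_le_right)
  rw [← hα', ← hβ']
  exact affineBlowUpChart_hom_ext hα hβ he hVe

variable (I) in
/-- The `Proj` of the Rees algebra is the blow-up of `Spec A`. -/
theorem isBlowUp_affineBlowUp : IsBlowUp (affineBlowUpProj I) (specIdeal I) where
  invertible := isInvertible_comap_affineBlowUpProj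
  universal {T} f hf := by
    refine existsUnique_lift_of_local _ f (fun t ↦ ?_) fun {W} j _ g g' hg hg' ↦ ?_
    · obtain ⟨V, htV, e, he, hVe⟩ := hf t
      obtain ⟨ρ, hρ, hI⟩ := exists_hom_fromSpec_comp (I := I) f V
      obtain ⟨g, hg⟩ := exists_lift_affineBlowUp he (hI.symm.trans hVe)
      exact ⟨_, V.2.fromSpec, V.2.isOpenImmersion_fromSpec, g,
        by rw [V.2.range_fromSpec]; exact htV, hg.trans hρ.symm⟩
    · refine affineBlowUp_lift_unique (f := j ≫ f) ?_ hg hg'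
      rw [Scheme.IdealSheafData.comap_comp]
      exact hf.comap_of_isOpenImmersion j

end AffineBlowUp

end

/-! ### Existence of blow-ups -/

theorem IsBlowUp.hom_ext {X Y T : Scheme.{u}} {π : Y ⟶ X} {I : X.IdealSheafData}
    (h : IsBlowUp π I) {g g' : T ⟶ Y} (hT : IsInvertible (I.comap (g ≫ π)))
    (e : g ≫ π = g' ≫ π) : g = g' :=
  (h.universal _ hT).unique rfl e.symm

theorem IsBlowUp.exists_lift {X Y T : Scheme.{u}} {π : Y ⟶ X} {I : X.IdealSheafData}
    (h : IsBlowUp π I) (f : T ⟶ X) (hT : IsInvertible (I.comap f)) : ∃ g : T ⟶ Y, g ≫ π = f :=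
  (h.universal f hT).exists

theorem IsBlowUp.comp_isIso {X X' Y : Scheme.{u}} {π : Y ⟶ X'} {I : X.IdealSheafData}
    (e : X' ⟶ X) [IsIso e] (h : IsBlowUp π (I.comap e)) : IsBlowUp (π ≫ e) I where
  invertible := by rw [Scheme.IdealSheafData.comap_comp]; exact h.invertible
  universal {T} f hf := by
    have := h.universal (f ≫ inv e) (by
      rw [← Scheme.IdealSheafData.comap_comp, Category.assoc, IsIso.inv_hom_id, Category.comp_id]
      exact hf)
    simpa [IsIso.eq_comp_inv] using this

theorem IsBlowUp.isIso_comp {X Y Y' : Scheme.{u}} {π : Y ⟶ X} {I : X.IdealSheafData}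
    (e : Y' ⟶ Y) [IsIso e] (h : IsBlowUp π I) : IsBlowUp (e ≫ π) I where
  invertible := by
    rw [Scheme.IdealSheafData.comap_comp]
    exact h.invertible.comap_of_isOpenImmersion e
  universal {T} f hf := by
    obtain ⟨g, hg, hu⟩ := h.universal f hf
    refine ⟨g ≫ inv e, by simpa using hg, fun g' hg' ↦ ?_⟩
    rw [IsIso.eq_comp_inv]
    exact hu _ (by simpa using hg')

/-- Blow-ups are compatible with the restriction to open subschemes of the base. -/
theorem IsBlowUp.isPullback {U V Y Z : Scheme.{u}} {j : U ⟶ V} [IsOpenImmersion j] {π : Y ⟶ V}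
    {ρ : Z ⟶ U} {I : V.IdealSheafData} (hπ : IsBlowUp π I) (hρ : IsBlowUp ρ (I.comap j))
    {g : Z ⟶ Y} (hg : g ≫ π = ρ ≫ j) : IsPullback g ρ π j := by
  have hP : IsInvertible (I.comap (pullback.snd π j ≫ j)) := by
    rw [← pullback.condition, Scheme.IdealSheafData.comap_comp]
    exact hπ.invertible.comap_of_isOpenImmersion _
  obtain ⟨m, hm⟩ := hρ.exists_lift (pullback.snd π j) (by
    rwa [← Scheme.IdealSheafData.comap_comp])
  have h₁ : pullback.lift g ρ hg ≫ m = 𝟙 Z := by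
    have e : (pullback.lift g ρ hg ≫ m) ≫ ρ = ρ := by
      rw [Category.assoc, hm, pullback.lift_snd]
    refine hρ.hom_ext ?_ ?_
    · rw [e]; exact hρ.invertible
    · rw [e, Category.id_comp]
  have h₂ : m ≫ pullback.lift g ρ hg = 𝟙 _ := by
    have e : m ≫ g ≫ π = pullback.snd π j ≫ j := by rw [hg, reassoc_of% hm]
    refine pullback.hom_ext ?_ ?_
    · rw [Category.assoc, pullback.lift_fst, Category.id_comp]
      refine hπ.hom_ext ?_ ?_
      · rw [Category.assoc, e]; exact hP
      · rw [Category.assoc, e, pullback.condition]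
    · rw [Category.assoc, pullback.lift_snd, Category.id_comp, hm]
  exact .of_iso_pullback ⟨hg⟩ ⟨pullback.lift g ρ hg, m, h₁, h₂⟩ (pullback.lift_fst _ _ _)
    (pullback.lift_snd _ _ _)

/-- Being a blow-up is local on the base. -/
theorem isBlowUp_of_openCover {X Y : Scheme.{u}} (π : Y ⟶ X) (I : X.IdealSheafData)
    (𝒰 : X.OpenCover)
    (h : ∀ i, IsBlowUp (pullback.snd π (𝒰.f i)) (I.comap (𝒰.f i))) : IsBlowUp π I where
  invertible := by
    refine isInvertible_of_openCover (𝒰.pullback₁ π) fun i ↦ ?_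
    have := (h i).invertible
    rwa [← Scheme.IdealSheafData.comap_comp, ← pullback.condition,
      Scheme.IdealSheafData.comap_comp] at this
  universal {T} f hf := by
    have key {W : Scheme.{u}} (j : W ⟶ T) [IsOpenImmersion j] (i) :
        IsInvertible ((I.comap (𝒰.f i)).comap (pullback.snd (j ≫ f) (𝒰.f i))) := by
      rw [← Scheme.IdealSheafData.comap_comp, ← pullback.condition, ← Category.assoc,
        Scheme.IdealSheafData.comap_comp]
      exact hf.comap_of_isOpenImmersion _
    refine existsUnique_lift_of_local π f (fun t ↦ ?_) fun {W} j _ g g' hg hg' ↦ ?_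
    · obtain ⟨i, x, hx⟩ := 𝒰.exists_eq (f t)
      obtain ⟨z, hz, -⟩ := Scheme.Pullback.exists_preimage_pullback t x hx.symm
      have := key (𝟙 T) i
      rw [Category.id_comp] at this
      obtain ⟨g, hg⟩ := (h i).exists_lift _ this
      refine ⟨_, pullback.fst f (𝒰.f i), inferInstance, g ≫ pullback.fst _ _, ⟨z, hz⟩, ?_⟩
      rw [Category.assoc, pullback.condition, reassoc_of% hg, pullback.condition]
    · refine hom_ext_of_forall_exists fun t ↦ ?_
      obtain ⟨i, x, hx⟩ := 𝒰.exists_eq ((j ≫ f) t)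
      obtain ⟨z, hz, -⟩ := Scheme.Pullback.exists_preimage_pullback t x hx.symm
      refine ⟨_, pullback.fst (j ≫ f) (𝒰.f i), inferInstance, ⟨z, hz⟩, ?_⟩
      have hw : (pullback.fst (j ≫ f) (𝒰.f i) ≫ g) ≫ π =
          pullback.snd (j ≫ f) (𝒰.f i) ≫ 𝒰.f i := by
        rw [Category.assoc, hg, pullback.condition]
      have hw' : (pullback.fst (j ≫ f) (𝒰.f i) ≫ g') ≫ π =
          pullback.snd (j ≫ f) (𝒰.f i) ≫ 𝒰.f i := by
        rw [Category.assoc, hg', pullback.condition]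
      have : pullback.lift _ _ hw = pullback.lift _ _ hw' := by
        refine (h i).hom_ext ?_ (by rw [pullback.lift_snd, pullback.lift_snd])
        rw [pullback.lift_snd]
        exact key j i
      have := congrArg (· ≫ pullback.fst _ _) this
      simp only [pullback.lift_fst] at this
      exact this

theorem exists_isBlowUp_of_affineOpen {X : Scheme.{u}} {I : X.IdealSheafData}
    (hI : IsFiniteType I) (U : X.affineOpens) :
    ∃ (Y : Scheme.{u}) (π : Y ⟶ U.1.toScheme), IsBlowUp π (I.comap U.1.ι) ∧
      IsSeparated π ∧ LocallyOfFiniteType π ∧ QuasiCompact π := by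
  have e : U.2.isoSpec.inv ≫ U.1.ι = U.2.fromSpec := rfl
  have := affineBlowUpProj_locallyOfFiniteType (hI U)
  have := affineBlowUpProj_quasiCompact (hI U)
  refine ⟨affineBlowUp (I.ideal U), affineBlowUpProj (I.ideal U) ≫ U.2.isoSpec.inv, ?_,
    inferInstance, inferInstance, inferInstance⟩
  refine IsBlowUp.comp_isIso _ ?_
  rw [← Scheme.IdealSheafData.comap_comp, e, comap_fromSpec]
  exact isBlowUp_affineBlowUp _

/-- The blow-up of a scheme along an ideal sheaf of finite type exists, and it is separated and of
finite type. -/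
theorem exists_isBlowUp {X : Scheme.{u}} {I : X.IdealSheafData} (hI : IsFiniteType I) :
    ∃ (Y : Scheme.{u}) (π : Y ⟶ X), IsBlowUp π I ∧
      IsSeparated π ∧ LocallyOfFiniteType π ∧ QuasiCompact π := by
  choose Y π hπ hs hf hq using exists_isBlowUp_of_affineOpen hI
  -- The blow-ups of the affine opens `U` are glued along the unique lifts `Y U ⟶ Y V` of the
  -- inclusions `U ≤ V`. Functoriality is uniqueness, and the squares over `U ≤ V` are cartesian
  -- because blow-ups restrict to open subschemes.
  let 𝒰 := Scheme.AffineZariskiSite.directedCover X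
  have hl (U V : X.affineOpens) (h : U.1 ≤ V.1) :
      IsInvertible ((I.comap V.1.ι).comap (π U ≫ X.homOfLE h)) := by
    rw [← Scheme.IdealSheafData.comap_comp, Category.assoc, Scheme.homOfLE_ι,
      Scheme.IdealSheafData.comap_comp]
    exact (hπ U).invertible
  choose m hm using fun U V h ↦ (hπ V).exists_lift _ (hl U V h)
  have hle {U V : 𝒰.I₀} (f : U ⟶ V) : U.1 ≤ V.1 :=
    ((Scheme.AffineZariskiSite.toOpensFunctor X).map f).le
  let d : 𝒰.RelativeGluingData :=
    { functor :=
        { obj U := Y U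
          map {U V} f := m U V (hle f)
          map_id U := by
            refine (hπ U).hom_ext ?_ ?_
            · exact (congrArg (fun q ↦ IsInvertible ((I.comap U.1.ι).comap q)) (hm U U le_rfl)).mpr
                (hl U U le_rfl)
            · refine (hm U U le_rfl).trans ?_
              rw [Category.id_comp, Scheme.homOfLE_rfl, Category.comp_id]
          map_comp {U V W} f g := by
            refine (hπ W).hom_ext ?_ ?_
            · exact (congrArg (fun q ↦ IsInvertible ((I.comap W.1.ι).comap q))
                (hm U W (hle (f ≫ g)))).mpr (hl U W (hle (f ≫ g)))
            · refine (hm U W (hle (f ≫ g))).trans ?_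
              refine .trans ?_ (Category.assoc _ _ _).symm
              refine .trans ?_ (congrArg (m U V (hle f) ≫ ·) (hm V W (hle g))).symm
              refine .trans ?_ (Category.assoc _ _ _)
              refine .trans ?_ (congrArg (· ≫ X.homOfLE (hle g)) (hm U V (hle f))).symm
              rw [Category.assoc, Scheme.homOfLE_homOfLE] }
      natTrans :=
        { app U := π U
          naturality U V f := hm U V (hle f) }
      equifibered := fun U V f ↦ by
        have : IsBlowUp (π U) ((I.comap V.1.ι).comap (X.homOfLE (hle f))) := by
          rw [← Scheme.IdealSheafData.comap_comp, Scheme.homOfLE_ι]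
          exact hπ U
        exact (hπ V).isPullback this (hm U V (hle f)) }
  have : Quiver.IsThin 𝒰.I₀ := inferInstanceAs (Quiver.IsThin X.AffineZariskiSite)
  have : Small.{u} 𝒰.I₀ := inferInstanceAs (Small.{u} X.AffineZariskiSite)
  have hsnd (U : 𝒰.I₀) : ∃ e : pullback d.toBase (𝒰.f U) ≅ Y U,
      pullback.snd d.toBase (𝒰.f U) = e.hom ≫ π U :=
    ⟨(d.isPullback_natTrans_ι_toBase U).flip.isoPullback.symm,
      (d.isPullback_natTrans_ι_toBase U).flip.isoPullback_inv_snd.symm⟩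
  have : IsZariskiLocalAtTarget (@LocallyOfFiniteType : MorphismProperty Scheme.{u}) :=
    (HasAffineProperty.iff.mp (HasRingHomProperty.HasAffineProperty @LocallyOfFiniteType)).1
  have : IsZariskiLocalAtTarget (@QuasiCompact : MorphismProperty Scheme.{u}) :=
    (HasAffineProperty.iff.mp
      instHasAffinePropertyQuasiCompactCompactSpaceCarrierCarrierCommRingCat).1
  refine ⟨d.glued, d.toBase, ?_, ?_, ?_, ?_⟩
  · refine isBlowUp_of_openCover _ _ 𝒰 fun U ↦ ?_
    obtain ⟨e, he⟩ := hsnd U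
    rw [he]
    exact (hπ U).isIso_comp e.hom
  · refine IsZariskiLocalAtTarget.of_openCover 𝒰 fun U ↦ ?_
    obtain ⟨e, he⟩ := hsnd U
    have := hs U
    exact (congrArg _ he).mpr (inferInstanceAs (IsSeparated (e.hom ≫ π U)))
  · refine IsZariskiLocalAtTarget.of_openCover 𝒰 fun U ↦ ?_
    obtain ⟨e, he⟩ := hsnd U
    have := hf U
    exact (congrArg _ he).mpr (inferInstanceAs (LocallyOfFiniteType (e.hom ≫ π U)))
  · refine IsZariskiLocalAtTarget.of_openCover 𝒰 fun U ↦ ?_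
    obtain ⟨e, he⟩ := hsnd U
    have := hq U
    exact (congrArg _ he).mpr (inferInstanceAs (QuasiCompact (e.hom ≫ π U)))

/-! ### Products of ideal sheaves, and integrality of blow-ups -/

/-- If the product of two ideals is generated by a non-zero-divisor, then so is each factor, locally
on the spectrum. -/
theorem exists_map_eq_span_singleton_of_mul {R : Type u} [CommRing R] {I J : Ideal R} {f : R}
    (hf : f ∈ nonZeroDivisors R) (h : I * J = Ideal.span {f}) :
    ∃ s : Set R, Ideal.span s = ⊤ ∧ ∀ c ∈ s, ∀ (S : Type u) [CommRing S] [Algebra R S]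
      [IsLocalization.Away c S], ∃ a ∈ nonZeroDivisors S,
        I.map (algebraMap R S) = Ideal.span {a} := by
  -- Writing `f = ∑ aᵢ bᵢ` and `aᵢ bᵢ = cᵢ f` gives `∑ cᵢ = 1`; where `cᵢ` is invertible, `aᵢ`
  -- generates `I`.
  refine ⟨{c | ∃ a ∈ I, ∃ b ∈ J, a * b = c * f}, ?_, ?_⟩
  · have key : ∀ z ∈ I * J, ∃ c ∈ Ideal.span {c | ∃ a ∈ I, ∃ b ∈ J, a * b = c * f},
        z = c * f := by
      intro z hz
      refine Submodule.mul_induction_on hz (fun a ha b hb ↦ ?_) ?_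
      · obtain ⟨c, hc⟩ := Ideal.mem_span_singleton'.mp (h ▸ Ideal.mul_mem_mul ha hb)
        exact ⟨c, Ideal.subset_span ⟨a, ha, b, hb, hc.symm⟩, hc.symm⟩
      · rintro _ _ ⟨c, hc, rfl⟩ ⟨d, hd, rfl⟩
        exact ⟨c + d, add_mem hc hd, (add_mul _ _ _).symm⟩
    obtain ⟨c, hc, e⟩ := key f (h ▸ Ideal.mem_span_singleton_self f)
    rw [Ideal.eq_top_iff_one]
    convert hc
    exact (mul_cancel_right_mem_nonZeroDivisors hf).mp (by rw [one_mul, ← e])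
  · rintro c ⟨a, ha, b, hb, e⟩ S _ _ _
    have hc := IsLocalization.Away.algebraMap_isUnit (S := S) c
    refine ⟨algebraMap R S a, ?_, le_antisymm ?_ ?_⟩
    · have h1 := IsLocalization.nonZeroDivisors_le_comap (Submonoid.powers c) S hf
      have h2 : algebraMap R S a * algebraMap R S b ∈ nonZeroDivisors S := by
        rw [← map_mul, e, map_mul]
        exact mul_mem hc.mem_nonZeroDivisors h1
      exact (mul_mem_nonZeroDivisors.mp h2).1
    · rw [Ideal.map_le_iff_le_comap]
      intro a' ha'
      obtain ⟨c', hc'⟩ := Ideal.mem_span_singleton'.mp (h ▸ Ideal.mul_mem_mul ha' hb)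
      have e' : c * a' = c' * a := (mul_cancel_right_mem_nonZeroDivisors hf).mp (by
        linear_combination (-a') * e + (-a) * hc')
      rw [Ideal.mem_comap, ← Ideal.unit_mul_mem_iff_mem _ hc, ← map_mul, e', map_mul]
      exact Ideal.mul_mem_left _ _ (Ideal.mem_span_singleton_self _)
    · rw [Ideal.span_singleton_le_iff_mem]
      exact Ideal.mem_map_of_mem _ ha

theorem IsInvertible.mul {Y : Scheme.{u}} {I J : Y.IdealSheafData} (hI : IsInvertible I)
    (hJ : IsInvertible J) : IsInvertible (I * J) := by
  intro y
  obtain ⟨U, hyU, f, hf, hUf⟩ := hI y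
  obtain ⟨V, hyV, g, hg, hVg⟩ := hJ y
  obtain ⟨r, t, e, hy⟩ := exists_basicOpen_le_affine_inter U.2 V.2 y ⟨hyU, hyV⟩
  have e' : Y.affineBasicOpen r = Y.affineBasicOpen t := Subtype.ext e
  have h1 : ∃ f ∈ nonZeroDivisors Γ(Y, (Y.affineBasicOpen r).1),
      I.ideal (Y.affineBasicOpen r) = Ideal.span {f} :=
    ⟨_, map_basicOpen_mem_nonZeroDivisors U r f hf, by
      rw [← I.map_ideal_basicOpen U r, hUf, Ideal.map_span, Set.image_singleton]; rfl⟩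
  have h2 : ∃ g ∈ nonZeroDivisors Γ(Y, (Y.affineBasicOpen t).1),
      J.ideal (Y.affineBasicOpen t) = Ideal.span {g} :=
    ⟨_, map_basicOpen_mem_nonZeroDivisors V t g hg, by
      rw [← J.map_ideal_basicOpen V t, hVg, Ideal.map_span, Set.image_singleton]; rfl⟩
  rw [← e'] at h2
  obtain ⟨f', hf', h1⟩ := h1
  obtain ⟨g', hg', h2⟩ := h2
  refine ⟨_, hy, f' * g', mul_mem hf' hg', ?_⟩
  rw [Scheme.IdealSheafData.ideal_mul, Pi.mul_apply, h1, h2,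
    Ideal.span_singleton_mul_span_singleton]

theorem IsInvertible.of_mul_left {Y : Scheme.{u}} {I J : Y.IdealSheafData}
    (h : IsInvertible (I * J)) : IsInvertible I := by
  intro y
  obtain ⟨U, hyU, f, hf, hUf⟩ := h y
  rw [Scheme.IdealSheafData.ideal_mul, Pi.mul_apply] at hUf
  obtain ⟨s, hs, H⟩ := exists_map_eq_span_singleton_of_mul hf hUf
  have hy : y ∈ ⨆ r : s, Y.basicOpen r.1 := by
    rwa [U.2.iSup_basicOpen_eq_self_iff.mpr hs]
  obtain ⟨⟨c, hc⟩, hyc⟩ := Opens.mem_iSup.mp hy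
  let _ := (Y.presheaf.map (homOfLE (Y.basicOpen_le c)).op).hom.toAlgebra
  have := U.2.isLocalization_basicOpen c
  obtain ⟨a, ha, h⟩ := H c hc Γ(Y, Y.basicOpen c)
  exact ⟨Y.affineBasicOpen c, hyc, a, ha, by rw [← I.map_ideal_basicOpen U c]; exact h⟩

theorem IsInvertible.of_mul_right {Y : Scheme.{u}} {I J : Y.IdealSheafData}
    (h : IsInvertible (I * J)) : IsInvertible J :=
  IsInvertible.of_mul_left (J := I) (by rwa [mul_comm])

theorem isInvertible_top {Y : Scheme.{u}} : IsInvertible (⊤ : Y.IdealSheafData) := fun y ↦ by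
  obtain ⟨U, hU, -⟩ := exists_affineOpens_le (X := Y) ⊤ (x := y) trivial
  exact ⟨U, hU, 1, one_mem _, by simp⟩

theorem IsInvertible.ne_bot {Y : Scheme.{u}} [Nonempty Y] {I : Y.IdealSheafData}
    (h : IsInvertible I) : I ≠ ⊥ := by
  rintro rfl
  obtain ⟨U, hU, f, hf, e⟩ := h (Classical.arbitrary Y)
  have : Nonempty U.1 := ⟨⟨_, hU⟩⟩
  have : f = 0 := Ideal.span_singleton_eq_bot.mp (by rw [← e]; simp)
  exact nonZeroDivisors.ne_zero hf this

/-- On an integral scheme, an ideal sheaf which vanishes on one nonempty affine open is zero. -/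
theorem ideal_ne_bot {Y : Scheme.{u}} [IsIntegral Y] {I : Y.IdealSheafData} (h : I ≠ ⊥)
    (U : Y.affineOpens) [hU : Nonempty U.1] : I.ideal U ≠ ⊥ := by
  contrapose! h
  ext W s
  simp only [Scheme.IdealSheafData.ideal_bot, Pi.bot_apply, Ideal.mem_bot]
  refine ⟨fun hs ↦ ?_, fun hs ↦ hs ▸ zero_mem _⟩
  obtain hW | hW := isEmpty_or_nonempty W.1
  · have : W.1 = ⊥ := by ext x; simpa using fun hx ↦ hW.false ⟨x, hx⟩
    have : Subsingleton Γ(Y, W.1) := by rw [this]; infer_instance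
    exact Subsingleton.elim _ _
  obtain ⟨x, hxU, hxW⟩ := nonempty_preirreducible_inter U.1.isOpen W.1.isOpen
    (by obtain ⟨x⟩ := hU; exact ⟨x.1, x.2⟩) (by obtain ⟨x⟩ := hW; exact ⟨x.1, x.2⟩)
  obtain ⟨V, hxV, hV⟩ := exists_affineOpens_le (U.1 ⊓ W.1) (x := x) ⟨hxU, hxW⟩
  have : Nonempty V.1 := ⟨⟨x, hxV⟩⟩
  have h1 : I.ideal V = ⊥ := by
    rw [← I.map_ideal (U := V) (V := U) (hV.trans inf_le_left), h, Ideal.map_bot]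
  have h2 := Ideal.mem_map_of_mem (Y.presheaf.map (homOfLE (hV.trans inf_le_right)).op).hom hs
  have h3 := I.map_ideal (U := V) (V := W) (hV.trans inf_le_right)
  have h4 : (Y.presheaf.map (homOfLE (hV.trans inf_le_right)).op).hom s ∈ I.ideal V := h3 ▸ h2
  rw [h1] at h4
  exact (map_eq_zero_iff _ (map_injective_of_isIntegral Y (homOfLE (hV.trans inf_le_right)))).mp h4

/-- The inverse image of an invertible ideal sheaf on an integral scheme is invertible unless it
is zero. -/
theorem IsInvertible.comap_of_ne_bot {X Y : Scheme.{u}} [IsIntegral X] {I : Y.IdealSheafData}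
    (hI : IsInvertible I) (f : X ⟶ Y) (h : I.comap f ≠ ⊥) : IsInvertible (I.comap f) := by
  intro x
  obtain ⟨U, hU, g, hg, hUg⟩ := hI (f x)
  obtain ⟨V, hxV, hV⟩ := exists_affineOpens_le (f ⁻¹ᵁ U.1) (x := x) hU
  have : Nonempty V.1 := ⟨⟨x, hxV⟩⟩
  have e : (I.comap f).ideal V = Ideal.span {(f.appLE U.1 V.1 hV).hom g} := by
    rw [ideal_comap f I U V hV, hUg, Ideal.map_span, Set.image_singleton]
  refine ⟨V, hxV, _, mem_nonZeroDivisors_of_ne_zero fun h0 ↦ ideal_ne_bot h V ?_, e⟩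
  rw [e, h0, Ideal.span_singleton_eq_bot]

/-- On the spectrum of a Bézout domain every nonzero ideal sheaf of finite type is invertible. -/
theorem IsFiniteType.isInvertible_of_isBezout {O : CommRingCat.{u}} [IsDomain O] [IsBezout O]
    {I : (Spec O).IdealSheafData} (hI : IsFiniteType I) (h : I ≠ ⊥) : IsInvertible I := by
  intro y
  let U : (Spec O).affineOpens := ⟨⊤, isAffineOpen_top _⟩
  have : Nonempty U.1 := ⟨⟨y, trivial⟩⟩
  have : IsBezout Γ(Spec O, U.1) :=
    Function.Surjective.isBezout (Scheme.ΓSpecIso O).symm.commRingCatIsoToRingEquiv.toRingHom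
      (Scheme.ΓSpecIso O).symm.commRingCatIsoToRingEquiv.surjective
  obtain ⟨f, hf⟩ := IsBezout.isPrincipal_of_FG _ (hI U)
  refine ⟨U, trivial, f, mem_nonZeroDivisors_of_ne_zero fun h0 ↦ ideal_ne_bot h U ?_, hf⟩
  rw [hf, h0]; simp

theorem isBlowUp_id_top {X : Scheme.{u}} : IsBlowUp (𝟙 X) (⊤ : X.IdealSheafData) where
  invertible := by rw [Scheme.IdealSheafData.comap_top]; exact isInvertible_top
  universal f _ := ⟨f, Category.comp_id f, fun g hg ↦ by rw [← hg, Category.comp_id]⟩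

theorem comap_eq_top_of_forall_notMem {X Y : Scheme.{u}} (f : X ⟶ Y) (I : Y.IdealSheafData)
    (h : ∀ x, f x ∉ I.support) : I.comap f = ⊤ := by
  rw [← Scheme.IdealSheafData.support_eq_bot_iff, Scheme.IdealSheafData.support_comap]
  ext x
  simpa using h x

theorem exists_notMem_support {X : Scheme.{u}} [IsReduced X] {I : X.IdealSheafData} (h : I ≠ ⊥) :
    ∃ x, x ∉ I.support := by
  contrapose! h
  rw [← Scheme.IdealSheafData.support_eq_top_iff]
  ext x
  simpa using h x

/-- The blow-up of an integral scheme along a nonzero ideal sheaf is integral. -/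
theorem IsBlowUp.isIntegral {X Y : Scheme.{u}} [IsIntegral X] {π : Y ⟶ X} {I : X.IdealSheafData}
    (h : IsBlowUp π I) (hI : I ≠ ⊥) : IsIntegral Y := by
  -- The blow-up is an isomorphism over the complement `W` of the center; `i` is the inverse. The
  -- rest of `Y` is locally cut out by one non-zero-divisor, so `W` is schematically dense in `Y`.
  let W : X.Opens := I.support.compl
  obtain ⟨w, hw⟩ := exists_notMem_support hI
  have hWtop : I.comap W.ι = ⊤ := comap_eq_top_of_forall_notMem _ _ fun x ↦ x.2
  obtain ⟨i, hi⟩ := h.exists_lift W.ι (hWtop ▸ isInvertible_top)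
  have hpb : IsPullback i (𝟙 _) π W.ι :=
    h.isPullback (hWtop ▸ isBlowUp_id_top) (by rw [hi, Category.id_comp])
  have hio : IsOpenImmersion i :=
    MorphismProperty.of_isPullback (P := @IsOpenImmersion) hpb.flip inferInstance
  have hrange (y : Y) (hy : π y ∉ I.support) : y ∈ i.opensRange := by
    obtain ⟨z, hz, -⟩ := Scheme.exists_preimage_of_isPullback hpb y ⟨π y, hy⟩ rfl
    exact ⟨z, hz⟩
  have hbasic (V : Y.affineOpens) (f : Γ(Y, V.1)) (hf : f ∈ (I.comap π).ideal V) :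
      Y.basicOpen f ≤ i.opensRange := by
    intro y hy
    refine hrange y fun hs ↦ ?_
    have hs' : y ∈ (I.comap π).support := by
      rw [Scheme.IdealSheafData.support_comap]; exact hs
    rw [Scheme.IdealSheafData.mem_support_iff_of_mem (U := V) (Y.basicOpen_le f hy),
      Scheme.mem_zeroLocus_iff] at hs'
    exact hs' f hf hy
  have : Nonempty W := ⟨⟨w, hw⟩⟩
  have hirr : IrreducibleSpace Y := by
    have hd : DenseRange i := by
      refine dense_iff_inter_open.mpr fun O hO ⟨y, hy⟩ ↦ ?_
      obtain ⟨V, hyV, hVO, f, hf, hVf⟩ := h.invertible.exists_le (W := ⟨O, hO⟩) hy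
      have : Nonempty V.1 := ⟨⟨y, hyV⟩⟩
      have hne : Y.basicOpen f ≠ ⊥ := by
        rw [Ne, ← Scheme.isNilpotent_iff_basicOpen_eq_bot_of_isCompact V.2.isCompact]
        rintro ⟨n, hn⟩
        exact nonZeroDivisors.ne_zero (pow_mem hf n) hn
      obtain ⟨z, hz⟩ := (Opens.ne_bot_iff_nonempty _).mp hne
      exact ⟨z, hVO (Y.basicOpen_le f hz),
        hbasic V f (hVf ▸ Ideal.mem_span_singleton_self f) hz⟩
    have := (IrreducibleSpace.isIrreducible_univ W).image i i.continuous.continuousOn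
    have := this.closure
    rw [Set.image_univ, hd.closure_range] at this
    exact (irreducibleSpace_def _).mpr this
  have hred : IsReduced Y := by
    have (y : Y) : _root_.IsReduced (Y.presheaf.stalk y) := by
      obtain ⟨V, hyV, f, hf, hVf⟩ := h.invertible y
      have hD := hbasic V f (hVf ▸ Ideal.mem_span_singleton_self f)
      have := i.isIso_app _ hD
      have hred : _root_.IsReduced Γ(Y, Y.basicOpen f) :=
        isReduced_of_injective (i.app (Y.basicOpen f)).hom
          ((ConcreteCategory.bijective_of_isIso (i.app (Y.basicOpen f))).1)
      let _ := (Y.presheaf.map (homOfLE (Y.basicOpen_le f)).op).hom.toAlgebra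
      have := V.2.isLocalization_basicOpen f
      have hinj := IsLocalization.injective (M := Submonoid.powers f) Γ(Y, Y.basicOpen f)
        (Submonoid.powers_le.mpr hf)
      have hredV : _root_.IsReduced Γ(Y, V.1) := isReduced_of_injective _ hinj
      let _ := Y.presheaf.algebra_section_stalk ⟨y, hyV⟩
      have := V.2.isLocalization_stalk ⟨y, hyV⟩
      exact isReduced_localizationPreserves (V.2.primeIdealOf ⟨y, hyV⟩).asIdeal.primeCompl _ hredV
    exact isReduced_of_isReduced_stalk Y
  exact isIntegral_of_irreducibleSpace_of_isReduced Y

/-! ### Extension of ideal sheaves of finite type -/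

/-- An extended ideal which is finitely generated is the extension of a finitely generated ideal. -/
theorem exists_fg_le_map_eq {R S : Type*} [CommRing R] [CommRing S] (f : R →+* S)
    (I : Ideal R) (h : (I.map f).FG) : ∃ L ≤ I, L.FG ∧ L.map f = I.map f := by
  classical
  obtain ⟨t, ht, e⟩ := (Submodule.fg_span_iff_fg_span_finset_subset (R := S) (f '' I)).mp h
  obtain ⟨u, hu, rfl⟩ := Finset.subset_set_image_iff.mp ht
  refine ⟨Ideal.span u, Ideal.span_le.mpr hu, ⟨u, rfl⟩, ?_⟩
  rw [Ideal.map_span, ← Finset.coe_image]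
  exact e.symm

/-- Membership in the kernel ideal sheaf of `q` may be checked locally, near the points of the image
of `q`. -/
theorem mem_ker_ideal_of_forall_exists {T Z : Scheme.{u}} (q : T ⟶ Z) [QuasiCompact q]
    (V : Z.affineOpens) {a : Γ(Z, V.1)} (h : ∀ z ∈ V.1, z ∈ Set.range q →
      ∃ (W : Z.affineOpens) (hW : W.1 ≤ V.1), z ∈ W.1 ∧
        (Z.presheaf.map (homOfLE hW).op).hom a ∈ q.ker.ideal W) : a ∈ q.ker.ideal V := by
  rw [Scheme.Hom.ker_apply, RingHom.mem_ker]
  apply T.IsSheaf.section_ext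
  intro x hx
  obtain ⟨W, hW, hxW, h⟩ := h (q x) hx ⟨x, rfl⟩
  refine ⟨q ⁻¹ᵁ W.1, q.preimage_mono hW, hxW, ?_⟩
  rw [Scheme.Hom.ker_apply, RingHom.mem_ker] at h
  rw [map_zero, ← h]
  exact congr($(q.naturality (homOfLE hW).op) a).symm

/-- The closed subscheme of the affine open `V` cut out by `L`, as a scheme over `Z`. -/
def quotientToScheme {Z : Scheme.{u}} (V : Z.affineOpens) (L : Ideal Γ(Z, V.1)) :
    Spec (.of (Γ(Z, V.1) ⧸ L)) ⟶ Z :=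
  Spec.map (CommRingCat.ofHom (Ideal.Quotient.mk L)) ≫ V.2.fromSpec

theorem range_quotientToScheme_subset {Z : Scheme.{u}} (V : Z.affineOpens)
    (L : Ideal Γ(Z, V.1)) : Set.range (quotientToScheme V L) ⊆ V.1 := by
  rintro _ ⟨x, rfl⟩
  rw [← V.2.range_fromSpec]
  exact ⟨_, rfl⟩

/-- The kernel of `Spec (Γ(Z, V) ⧸ L) ⟶ Z` is the largest ideal sheaf on `Z` which extends `L`. -/
theorem ideal_ker_quotientToScheme {Z : Scheme.{u}} [QuasiSeparatedSpace Z] (V : Z.affineOpens)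
    (L : Ideal Γ(Z, V.1)) : (quotientToScheme V L).ker.ideal V = L := by
  set q := quotientToScheme V L with hq
  have htop : (⊤ : (Spec (.of (Γ(Z, V.1) ⧸ L))).Opens) ≤ q ⁻¹ᵁ V.1 :=
    fun x _ ↦ range_quotientToScheme_subset V L ⟨x, rfl⟩
  have hiff (a : Γ(Z, V.1)) : (q.app V.1).hom a = 0 ↔ (q.appLE V.1 ⊤ htop).hom a = 0 := by
    constructor <;> intro h
    · rw [Scheme.Hom.appLE, CommRingCat.comp_apply, h, map_zero]
    · rw [Scheme.Hom.app_eq_appLE, ← q.appLE_map (U := V.1) htop (homOfLE le_top).op,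
        CommRingCat.comp_apply, h, map_zero]
  have happ : q.appLE V.1 ⊤ htop = CommRingCat.ofHom (Ideal.Quotient.mk L) ≫
      (Scheme.ΓSpecIso (.of (Γ(Z, V.1) ⧸ L))).inv := by
    rw [Scheme.ΓSpecIso_inv_naturality]
    refine .trans ?_ (congrArg (· ≫ Scheme.Hom.appTop _) (fromSpec_appLE_top V))
    rw [Scheme.Hom.appTop, Scheme.Hom.app_eq_appLE]
    exact (Scheme.Hom.appLE_comp_appLE _ _ _ _ _ _ _).symm
  ext a
  rw [Scheme.Hom.ker_apply, RingHom.mem_ker, hiff, happ, CommRingCat.comp_apply,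
    map_eq_zero_iff _ (ConcreteCategory.bijective_of_isIso
      (Scheme.ΓSpecIso (.of (Γ(Z, V.1) ⧸ L))).inv).1]
  exact Ideal.Quotient.eq_zero_iff_mem

/-- An ideal sheaf of finite type on an affine open subscheme extends to one of finite type. -/
theorem exists_isFiniteType_ideal_eq {Z : Scheme.{u}} [CompactSpace Z] [QuasiSeparatedSpace Z]
    (U : Z.affineOpens) {L : Ideal Γ(Z, U.1)} (hL : L.FG) :
    ∃ J : Z.IdealSheafData, IsFiniteType J ∧ J.ideal U = L := by
  -- The ideal is extended to `U ∪ S` for larger and larger finite unions `S` of affine opens.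
  have key (S : Z.Opens) (hS : IsCompact (S : Set Z)) :
      ∃ J : Z.IdealSheafData, J.ideal U = L ∧
        ∀ V : Z.affineOpens, V.1 ≤ U.1 ⊔ S → (J.ideal V).FG := by
    refine compact_open_induction_on S hS ?_ ?_
    · refine ⟨(quotientToScheme U L).ker, ideal_ker_quotientToScheme U L, fun V hV ↦ ?_⟩
      rw [sup_bot_eq] at hV
      rw [← (quotientToScheme U L).ker.map_ideal (U := V) (V := U) hV,
        ideal_ker_quotientToScheme]
      exact hL.map _
    · rintro S hS W ⟨J, hJ, hfg⟩
      have hcomp : IsCompact ((W.1 ⊓ (U.1 ⊔ S) : Z.Opens) : Set Z) :=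
        QuasiSeparatedSpace.inter_isCompact _ _ W.1.2 W.2.isCompact (U.1 ⊔ S).2
          (U.2.isCompact.union hS)
      have hloc (z : (W.1 ⊓ (U.1 ⊔ S) : Z.Opens)) :=
        exists_affineBasicOpen_le W (U.1 ⊔ S) z.2.1 z.2.2
      choose a hza ha using hloc
      obtain ⟨t, ht⟩ := hcomp.elim_finite_subcover (fun z ↦ (Z.affineBasicOpen (a z)).1)
        (fun z ↦ (Z.affineBasicOpen (a z)).1.2) fun z hz ↦ Set.mem_iUnion.mpr ⟨⟨z, hz⟩, hza _⟩
      have hL' (z) := exists_fg_le_map_eq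
        (Z.presheaf.map (homOfLE (Z.basicOpen_le (a z))).op).hom (J.ideal W) (by
          have := hfg _ (ha z)
          rwa [← J.map_ideal_basicOpen] at this)
      choose L' hL'J hL'fg hL' using hL'
      -- Finitely many sections `L₁` of `J` over `W` generate `J` on `W ∩ (U ∪ S)`. Cutting `J` down
      -- to the largest extension `N` of `L₁` makes it finitely generated on `W`, and nothing changes
      -- on `U ∪ S`.
      let L₁ : Ideal Γ(Z, W.1) := ⨆ z ∈ t, L' z
      have hL₁fg : L₁.FG := Submodule.fg_biSup t _ fun z _ ↦ hL'fg z
      have hL₁J : L₁ ≤ J.ideal W := iSup₂_le fun z _ ↦ hL'J z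
      let N := (quotientToScheme W L₁).ker
      have hNW : N.ideal W = L₁ := ideal_ker_quotientToScheme W L₁
      have hJW : (J ⊓ N).ideal W = L₁ := by
        rw [Scheme.IdealSheafData.ideal_inf, Pi.inf_apply, hNW, inf_eq_right.mpr hL₁J]
      have hJV (V : Z.affineOpens) (hV : V.1 ≤ U.1 ⊔ S) : (J ⊓ N).ideal V = J.ideal V := by
        rw [Scheme.IdealSheafData.ideal_inf, Pi.inf_apply, inf_eq_left]
        intro s hs
        refine mem_ker_ideal_of_forall_exists _ _ fun z hz hzr ↦ ?_
        have hzW := range_quotientToScheme_subset W L₁ hzr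
        obtain ⟨w, hw, hzw⟩ := Set.mem_iUnion₂.mp (ht ⟨hzW, hV hz⟩)
        obtain ⟨V', hzV', hV'⟩ := exists_affineOpens_le (V.1 ⊓ (Z.affineBasicOpen (a w)).1)
          (x := z) ⟨hz, hzw⟩
        refine ⟨V', hV'.trans inf_le_left, hzV', ?_⟩
        have h1 : (Z.presheaf.map (homOfLE (hV'.trans inf_le_left)).op).hom s ∈ J.ideal V' := by
          rw [← J.map_ideal (U := V') (V := V) (hV'.trans inf_le_left)]
          exact Ideal.mem_map_of_mem _ hs
        have h2 : J.ideal (Z.affineBasicOpen (a w)) ≤ N.ideal (Z.affineBasicOpen (a w)) := by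
          rw [← J.map_ideal_basicOpen, ← N.map_ideal_basicOpen, hNW, ← hL' w]
          exact Ideal.map_mono (le_biSup L' hw)
        have h3 : J.ideal V' ≤ N.ideal V' := by
          rw [← J.map_ideal (U := V') (V := Z.affineBasicOpen (a w)) (hV'.trans inf_le_right),
            ← N.map_ideal (U := V') (V := Z.affineBasicOpen (a w)) (hV'.trans inf_le_right)]
          exact Ideal.map_mono h2
        exact h3 h1
      refine ⟨J ⊓ N, (hJV U le_sup_left).trans hJ, fun V hV ↦ ?_⟩
      refine ideal_fg_of_forall_exists V fun z hz ↦ ?_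
      by_cases hzW : z ∈ W.1
      · exact ⟨W, hzW, hJW ▸ hL₁fg⟩
      · have hzUS : z ∈ U.1 ⊔ S := by
          rcases hV hz with h | h | h
          exacts [.inl h, .inr h, (hzW h).elim]
        obtain ⟨V', hzV', hV'⟩ := exists_affineOpens_le (U.1 ⊔ S) (x := z) hzUS
        exact ⟨V', hzV', hJV V' hV' ▸ hfg V' hV'⟩
  obtain ⟨J, hJ, h⟩ := key ⊤ isCompact_univ
  exact ⟨J, fun V ↦ h V (le_top.trans le_sup_right), hJ⟩

/-! ### Values of sections at points with values in a ring -/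

/-- The value of a section of `Y` over `U` at an `R`-valued point of `U`. -/
def evalOn {R : Type u} [CommRing R] {Y : Scheme.{u}} (φ : Spec (.of R) ⟶ Y) (U : Y.Opens)
    (hU : ⊤ ≤ φ ⁻¹ᵁ U) : Γ(Y, U) →+* R :=
  (φ.appLE U ⊤ hU ≫ (Scheme.ΓSpecIso (.of R)).hom).hom

theorem evalOn_comp {R : Type u} [CommRing R] {Y Z : Scheme.{u}} (φ : Spec (.of R) ⟶ Y)
    (σ : Y ⟶ Z) (U : Z.Opens) (V : Y.Opens) (hVU : V ≤ σ ⁻¹ᵁ U) (hV : ⊤ ≤ φ ⁻¹ᵁ V)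
    (hU : ⊤ ≤ (φ ≫ σ) ⁻¹ᵁ U) (s : Γ(Z, U)) :
    evalOn φ V hV ((σ.appLE U V hVU).hom s) = evalOn (φ ≫ σ) U hU s := by
  rw [evalOn, evalOn, ← Scheme.Hom.appLE_comp_appLE φ σ U V ⊤ hVU hV, Category.assoc,
    CommRingCat.comp_apply]
  rfl

theorem specMap_appLE_top {R S : Type u} [CommRing R] [CommRing S] (ρ : R →+* S) :
    (Spec.map (CommRingCat.ofHom ρ)).appLE ⊤ ⊤ le_top ≫ (Scheme.ΓSpecIso (.of S)).hom =
      (Scheme.ΓSpecIso (.of R)).hom ≫ CommRingCat.ofHom ρ := by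
  rw [← Scheme.ΓSpecIso_naturality, Scheme.Hom.appTop, Scheme.Hom.app_eq_appLE]
  rfl

theorem evalOn_specMap_top {R S : Type u} [CommRing R] [CommRing S] (ρ : R →+* S)
    (b : Γ(Spec (.of R), ⊤)) :
    evalOn (Spec.map (CommRingCat.ofHom ρ)) ⊤ le_top b =
      ρ ((Scheme.ΓSpecIso (.of R)).hom.hom b) :=
  congr($(specMap_appLE_top ρ) b)

theorem evalOn_specMap {R S : Type u} [CommRing R] [CommRing S] {Y : Scheme.{u}} (ρ : R →+* S)
    (φ : Spec (.of R) ⟶ Y) (U : Y.Opens) (hU : ⊤ ≤ φ ⁻¹ᵁ U)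
    (hU' : ⊤ ≤ (Spec.map (CommRingCat.ofHom ρ) ≫ φ) ⁻¹ᵁ U) (s : Γ(Y, U)) :
    evalOn (Spec.map (CommRingCat.ofHom ρ) ≫ φ) U hU' s = ρ (evalOn φ U hU s) := by
  have h := Scheme.Hom.appLE_comp_appLE (Spec.map (CommRingCat.ofHom ρ)) φ U ⊤ ⊤ hU le_top
  rw [evalOn, evalOn, ← h, Category.assoc]
  rw [specMap_appLE_top, ← Category.assoc, CommRingCat.comp_apply]
  rfl

theorem top_le_preimage {R : Type u} [CommRing R] [IsLocalRing R] {Y : Scheme.{u}}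
    {φ : Spec (.of R) ⟶ Y} {U : Y.Opens} (hU : φ (IsLocalRing.closedPoint R) ∈ U) :
    ⊤ ≤ φ ⁻¹ᵁ U :=
  (Scheme.preimage_eq_top_of_closedPoint_mem φ hU).ge

theorem stalkClosedPointTo_germ {R : Type u} [CommRing R] [IsLocalRing R] {Y : Scheme.{u}}
    (φ : Spec (.of R) ⟶ Y) (U : Y.Opens) (hU : φ (IsLocalRing.closedPoint R) ∈ U) (s : Γ(Y, U)) :
    (Scheme.stalkClosedPointTo φ).hom ((Y.presheaf.germ U _ hU).hom s) =
      evalOn φ U (top_le_preimage hU) s := by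
  have := congr($(Scheme.germ_stalkClosedPointTo φ U hU) s)
  rw [CommRingCat.comp_apply] at this
  refine this.trans ?_
  rw [evalOn, Scheme.Hom.appLE, Category.assoc]
  rfl

/-- Let `J` become invertible on `Y`, and let the value of `h ∈ J` at the `R`-valued point divide the
values of all elements of `J`. Then `h` generates `J` at the image of the closed point, and `g / h`
comes from the local ring of `Y` there, for every `g ∈ J`. -/
theorem exists_stalkClosedPointTo_eq {R : Type u} [CommRing R] [IsLocalRing R] [IsDomain R]
    {Y Z : Scheme.{u}} (φ : Spec (.of R) ⟶ Y) (σ : Y ⟶ Z) {J : Z.IdealSheafData}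
    (hJ : IsInvertible (J.comap σ)) (U : Z.affineOpens)
    (hU : ⊤ ≤ (φ ≫ σ) ⁻¹ᵁ U.1) {g h : Γ(Z, U.1)} (hg : g ∈ J.ideal U) (hh : h ∈ J.ideal U)
    (h0 : evalOn (φ ≫ σ) U.1 hU h ≠ 0)
    (hdvd : ∀ s ∈ J.ideal U, evalOn (φ ≫ σ) U.1 hU h ∣ evalOn (φ ≫ σ) U.1 hU s) :
    ∃ z, evalOn (φ ≫ σ) U.1 hU g =
      evalOn (φ ≫ σ) U.1 hU h * (Scheme.stalkClosedPointTo φ).hom z := by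
  have hc : φ (IsLocalRing.closedPoint R) ∈ σ ⁻¹ᵁ U.1 :=
    hU (x := IsLocalRing.closedPoint R) trivial
  obtain ⟨V, hcV, hVU, t, -, ht⟩ := hJ.exists_le hc
  rw [ideal_comap σ J U V hVU] at ht
  set ρ := (σ.appLE U.1 V.1 hVU).hom
  have hV := top_le_preimage hcV
  have hev (s) : evalOn φ V.1 hV (ρ s) = evalOn (φ ≫ σ) U.1 hU s :=
    evalOn_comp φ σ U.1 V.1 hVU hV hU s
  have hdvd' : (J.ideal U).map ρ ≤
      (Ideal.span {evalOn (φ ≫ σ) U.1 hU h}).comap (evalOn φ V.1 hV) := by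
    rw [Ideal.map_le_iff_le_comap]
    intro s hs
    rw [Ideal.mem_comap, Ideal.mem_comap, Ideal.mem_span_singleton, hev]
    exact hdvd s hs
  have ht' := hdvd' (ht ▸ Ideal.mem_span_singleton_self t)
  rw [Ideal.mem_comap, Ideal.mem_span_singleton] at ht'
  obtain ⟨u, hu⟩ := ht'
  obtain ⟨w, hw⟩ := Ideal.mem_span_singleton.mp (ht ▸ Ideal.mem_map_of_mem ρ hh)
  obtain ⟨v, hv⟩ := Ideal.mem_span_singleton.mp (ht ▸ Ideal.mem_map_of_mem ρ hg)
  -- `h = t w` in the local ring, where `t` is a generator of `J` whose value is a multiple of the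
  -- value of `h`, so that `w` is a unit
  have hw1 : u * evalOn φ V.1 hV w = 1 := by
    have := hev h
    rw [hw, map_mul, hu, mul_assoc] at this
    exact mul_left_cancel₀ h0 (this.trans (mul_one _).symm)
  have hwu : IsUnit ((Y.presheaf.germ V.1 _ hcV).hom w) := by
    refine isUnit_of_map_unit (Scheme.stalkClosedPointTo φ).hom _ ?_
    rw [stalkClosedPointTo_germ]
    exact .of_mul_eq_one_right _ hw1
  obtain ⟨w', hw'⟩ := hwu.exists_left_inv
  refine ⟨w' * (Y.presheaf.germ V.1 _ hcV).hom v, ?_⟩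
  have h1 := congrArg (Scheme.stalkClosedPointTo φ).hom hw'
  rw [map_mul, stalkClosedPointTo_germ, map_one] at h1
  rw [map_mul, stalkClosedPointTo_germ, ← hev g, ← hev h, hv, hw, map_mul, map_mul]
  linear_combination (-evalOn φ V.1 hV t * evalOn φ V.1 hV v) * h1

/-! ### Fractions representing elements of the double residue field -/

theorem mem_integers_iff {K : Type u} [NormedField K] [IsUltrametricDist K] {a : K} :
    a ∈ integers K ↔ ‖a‖ ≤ 1 := by
  rw [Valuation.mem_valuationSubring_iff, NormedField.valuation_apply]
  exact Iff.rfl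

theorem norm_coe_le_one {K : Type u} [NormedField K] [IsUltrametricDist K] (a : integers K) :
    ‖(a : K)‖ ≤ 1 := mem_integers_iff.mp a.2

theorem dvd_of_norm_le {K : Type u} [NormedField K] [IsUltrametricDist K] {a b : integers K}
    (h : ‖(b : K)‖ ≤ ‖(a : K)‖) : a ∣ b := by
  obtain rfl | ha := eq_or_ne a 0
  · have : b = 0 := by simpa using h
    rw [this]
  have ha' : (a : K) ≠ 0 := by simpa using ha
  refine ⟨⟨b / a, mem_integers_iff.mpr ?_⟩, Subtype.ext ?_⟩
  · rw [norm_div]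
    exact div_le_one_of_le₀ h (norm_nonneg _)
  · change (b : K) = a * (b / a)
    rw [mul_div_cancel₀ _ ha']

theorem residue_eq_of_norm_sub_lt_one {K : Type u} [NormedField K] [IsUltrametricDist K]
    {a b : integers K} (h : ‖(a : K) - b‖ < 1) :
    IsLocalRing.residue (integers K) a = IsLocalRing.residue (integers K) b := by
  rw [← sub_eq_zero, ← map_sub, IsLocalRing.residue_eq_zero_iff, IsLocalRing.mem_maximalIdeal]
  intro hu
  obtain ⟨c, hc⟩ := hu.exists_right_inv
  have h1 := congrArg (fun z : integers K ↦ ‖(z : K)‖) hc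
  have h2 : ‖(a : K) - b‖ * ‖(c : K)‖ = 1 := by simpa using h1
  nlinarith [norm_coe_le_one c, norm_nonneg (c : K), norm_nonneg ((a : K) - b)]

theorem top_le_preimage_fromSpecResidueField {X : Scheme.{u}} {p : X} {U : X.Opens} (hp : p ∈ U) :
    ⊤ ≤ X.fromSpecResidueField p ⁻¹ᵁ U := fun y _ ↦ by
  change X.fromSpecResidueField p y ∈ U
  rwa [Scheme.fromSpecResidueField_apply]

theorem evalOn_fromSpecResidueField {X : Scheme.{u}} (p : X) (U : X.Opens) (hp : p ∈ U)
    (s : Γ(X, U)) :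
    evalOn (R := X.residueField p) (X.fromSpecResidueField p) U
      (top_le_preimage_fromSpecResidueField hp) s = X.evaluation U p hp s := by
  have hU : ⊤ ≤ X.fromSpecStalk p ⁻¹ᵁ U := fun y _ ↦
    ((Scheme.range_fromSpecStalk (X := X) (x := p)).subset ⟨y, rfl⟩).mem_open U.isOpen hp
  have h : X.presheaf.germ U p hp =
      (X.fromSpecStalk p).appLE U ⊤ hU ≫ (Scheme.ΓSpecIso (X.presheaf.stalk p)).hom := by
    rw [← Iso.comp_inv_eq, Scheme.Hom.appLE, Scheme.fromSpecStalk_app hp, Category.assoc,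
      Category.assoc, ← Functor.map_comp]
    exact congrArg (_ ≫ ·) ((Category.comp_id _).symm.trans
      (congrArg (_ ≫ ·) ((Spec (X.presheaf.stalk p)).presheaf.map_id _).symm))
  exact (evalOn_specMap (R := X.presheaf.stalk p) (S := X.residueField p) (X.residue p).hom
    (X.fromSpecStalk p) U hU _ s).trans (congrArg (X.residue p).hom congr($h s).symm)

/-- The residue field at a point of an affine open `U` consists of fractions of sections
over `U`. -/
theorem exists_mul_evaluation_eq {X : Scheme.{u}} (p : X) (U : X.affineOpens) (hp : p ∈ U.1)
    (f : X.residueField p) : ∃ g h : Γ(X, U.1), X.evaluation U.1 p hp h ≠ 0 ∧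
      f * X.evaluation U.1 p hp h = X.evaluation U.1 p hp g := by
  obtain ⟨z, rfl⟩ := X.residue_surjective p f
  let _ := X.presheaf.algebra_section_stalk ⟨p, hp⟩
  have := U.2.isLocalization_stalk ⟨p, hp⟩
  obtain ⟨⟨g, h⟩, e⟩ := IsLocalization.surj (U.2.primeIdealOf ⟨p, hp⟩).asIdeal.primeCompl z
  refine ⟨g, h, ?_, ?_⟩
  · have := (IsLocalization.map_units (X.presheaf.stalk p) h).map (X.residue p).hom
    exact this.ne_zero
  · have := congrArg (X.residue p).hom e
    rw [map_mul] at this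
    exact this

section

variable {k : Type u} [NormedField k] {X : Scheme.{u}} {s : X ⟶ Spec (.of k)}

theorem AnPoint.norm_toComplField (x : AnPoint s) (f : X.residueField x.pt) :
    ‖x.toComplField f‖ = x.abv f :=
  UniformSpace.Completion.norm_coe _

theorem AnPoint.exists_norm_toComplField_sub_lt (x : AnPoint s) (a : x.complField) :
    ∃ f, ‖x.toComplField f - a‖ < 1 := by
  obtain ⟨f, hf⟩ := (UniformSpace.Completion.denseRange_coe (α := WithAbs x.abv)).exists_dist_lt
    a one_pos
  refine ⟨WithAbs.equiv x.abv f, ?_⟩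
  rw [dist_comm, dist_eq_norm] at hf
  exact hf

theorem AnPoint.evalOn_spec_comp (x : AnPoint s) {Z : Scheme.{u}} (ι : X ⟶ Z) (U : Z.Opens)
    (hU : ⊤ ≤ (x.spec ≫ ι) ⁻¹ᵁ U) (hp : ι x.pt ∈ U) (t : Γ(Z, U)) :
    evalOn (x.spec ≫ ι) U hU t =
      x.toComplField (ι.residueFieldMap x.pt (Z.evaluation U (ι x.pt) hp t)) := by
  have e : x.spec ≫ ι = Spec.map (CommRingCat.ofHom
      (x.toComplField.comp (ι.residueFieldMap x.pt).hom)) ≫ Z.fromSpecResidueField (ι x.pt) := by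
    rw [AnPoint.spec, Category.assoc, ← Scheme.Hom.SpecMap_residueFieldMap_fromSpecResidueField,
      CommRingCat.ofHom_comp, Spec.map_comp, Category.assoc]
    rfl
  simp only [e] at hU ⊢
  refine (evalOn_specMap (R := Z.residueField (ι x.pt)) _ (Z.fromSpecResidueField (ι x.pt)) U
    (top_le_preimage_fromSpecResidueField hp) hU t).trans ?_
  exact congrArg _ (evalOn_fromSpecResidueField _ _ hp t)

theorem AnPoint.spec_apply (x : AnPoint s) (y) : x.spec y = x.pt := by
  rw [AnPoint.spec, Scheme.Hom.comp_apply]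
  exact Scheme.fromSpecResidueField_apply x.pt _

theorem AnPoint.coe_evalOn (x : AnPoint s) {Z : Scheme.{u}} (ι : X ⟶ Z)
    {φ : Spec (.of (integers x.complField)) ⟶ Z}
    (hφ : specToIntegers x.complField ≫ φ = x.spec ≫ ι) (U : Z.Opens) (hU : ⊤ ≤ φ ⁻¹ᵁ U)
    (hp : ι x.pt ∈ U) (t : Γ(Z, U)) :
    (evalOn φ U hU t : x.complField) =
      x.toComplField (ι.residueFieldMap x.pt (Z.evaluation U (ι x.pt) hp t)) := by
  have hU' : ⊤ ≤ (specToIntegers x.complField ≫ φ) ⁻¹ᵁ U := fun y _ ↦ hU trivial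
  have hU'' : ⊤ ≤ (x.spec ≫ ι) ⁻¹ᵁ U := hφ ▸ hU'
  rw [← x.evalOn_spec_comp ι U hU'' hp]
  refine (evalOn_specMap (integers x.complField).subtype φ U hU hU' t).symm.trans ?_
  simp only [hφ]

theorem AnPoint.pt_mem (x : AnPoint s) {Z : Scheme.{u}} (ι : X ⟶ Z)
    {φ : Spec (.of (integers x.complField)) ⟶ Z}
    (hφ : specToIntegers x.complField ≫ φ = x.spec ≫ ι) (U : Z.Opens) (hU : ⊤ ≤ φ ⁻¹ᵁ U) :
    ι x.pt ∈ U := by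
  let y : Spec (.of x.complField) := IsLocalRing.closedPoint x.complField
  have h : φ (specToIntegers x.complField y) ∈ U := hU trivial
  rw [← Scheme.Hom.comp_apply, hφ, Scheme.Hom.comp_apply, x.spec_apply] at h
  exact h

/-- Every element of the double residue field is the residue of a quotient of two sections over a
given affine neighbourhood of the center: `κ(π(x))` is dense in `ℋ(x)`, and it consists of such
quotients. -/
theorem AnPoint.exists_fraction (x : AnPoint s) {Z : Scheme.{u}} (ι : X ⟶ Z) [IsOpenImmersion ι]
    {φ : Spec (.of (integers x.complField)) ⟶ Z}
    (hφ : specToIntegers x.complField ≫ φ = x.spec ≫ ι) (U : Z.affineOpens)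
    (hU : ⊤ ≤ φ ⁻¹ᵁ U.1) (ζ : x.doubleResidueField) :
    ∃ g h : Γ(Z, U.1), evalOn φ U.1 hU h ≠ 0 ∧ ∃ a,
      evalOn φ U.1 hU g = evalOn φ U.1 hU h * a ∧
        IsLocalRing.residue (integers x.complField) a = ζ := by
  obtain ⟨a₀, rfl⟩ := IsLocalRing.residue_surjective ζ
  obtain ⟨f, hf⟩ := x.exists_norm_toComplField_sub_lt a₀
  have hp := x.pt_mem ι hφ U.1 hU
  obtain ⟨f', rfl⟩ := (ConcreteCategory.bijective_of_isIso (ι.residueFieldMap x.pt)).2 f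
  obtain ⟨g, h, h0, e⟩ := exists_mul_evaluation_eq (ι x.pt) U hp f'
  -- `f'` is only an approximation of the given element of `ℋ(x)°`, but it has the same residue
  have hn : ‖x.toComplField (ι.residueFieldMap x.pt f')‖ ≤ 1 := by
    have := IsUltrametricDist.norm_add_le_max
      (x.toComplField (ι.residueFieldMap x.pt f') - a₀) (a₀ : x.complField)
    rw [sub_add_cancel] at this
    exact this.trans (max_le hf.le (norm_coe_le_one a₀))
  refine ⟨g, h, ?_, ⟨_, mem_integers_iff.mpr hn⟩, ?_, residue_eq_of_norm_sub_lt_one hf⟩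
  · intro h1
    have h2 := x.coe_evalOn ι hφ U.1 hU hp h
    rw [h1] at h2
    have h3 : (0 : x.complField) = x.toComplField _ := h2
    exact h0 ((map_eq_zero_iff _ (ι.residueFieldMap x.pt).hom.injective).mp
      ((map_eq_zero_iff _ x.toComplField.injective).mp h3.symm))
  · refine Subtype.ext ?_
    rw [x.coe_evalOn ι hφ U.1 hU hp g, ← e]
    refine .trans ?_ (mul_comm _ _)
    refine .trans ?_ (congrArg (_ * ·) (x.coe_evalOn ι hφ U.1 hU hp h).symm)
    rw [map_mul, map_mul]

end

/-! ### Images of local rings in the double residue field -/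

/-- The image in the residue field of `R` of the local ring of `Y` at the image of the closed point
of `Spec R`. -/
def residueRange {R : Type u} [CommRing R] [IsLocalRing R] {Y : Scheme.{u}}
    (φ : Spec (.of R) ⟶ Y) : Subring (IsLocalRing.ResidueField R) :=
  ((IsLocalRing.residue R).comp (Scheme.stalkClosedPointTo φ).hom).range

theorem residueRange_comp_le {R : Type u} [CommRing R] [IsLocalRing R] {Y Z : Scheme.{u}}
    (φ : Spec (.of R) ⟶ Y) (σ : Y ⟶ Z) : residueRange (φ ≫ σ) ≤ residueRange φ := by
  rintro _ ⟨z, rfl⟩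
  rw [Scheme.stalkClosedPointTo_comp]
  exact ⟨(σ.stalkMap _).hom z, rfl⟩

section

variable {k : Type u} [NormedField k] {X : Scheme.{u}} {s : X ⟶ Spec (.of k)} (x : AnPoint s)
  {Z : Scheme.{u}} (ι : X ⟶ Z) {φ : Spec (.of (integers x.complField)) ⟶ Z}

/-- Every element `ζ` of the double residue field comes from the local ring at the center on each
scheme over `Z` on which the ideal sheaf spanned by the numerator and the denominator of a fraction
representing `ζ` becomes invertible.  Multiples of the denominator may be added to the ideal. -/
theorem AnPoint.exists_ideal_mem_residueRange [IsOpenImmersion ι] [CompactSpace Z]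
    [QuasiSeparatedSpace Z] (hφ : specToIntegers x.complField ≫ φ = x.spec ≫ ι)
    (ζ : x.doubleResidueField) :
    ∃ a : integers x.complField, a ≠ 0 ∧ ∃ J : Z.IdealSheafData, IsFiniteType J ∧ J ≠ ⊥ ∧
      ∀ K : Z.IdealSheafData, (∀ (U : Z.affineOpens) (hU : ⊤ ≤ φ ⁻¹ᵁ U.1), ∀ t ∈ K.ideal U,
        a ∣ evalOn φ U.1 hU t) → ∀ {Y : Scheme.{u}} (φ' : Spec (.of (integers x.complField)) ⟶ Y)
        (σ : Y ⟶ Z), φ' ≫ σ = φ → IsInvertible ((J ⊔ K).comap σ) → ζ ∈ residueRange φ' := by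
  obtain ⟨U, hcU, -⟩ := exists_affineOpens_le (X := Z) ⊤
    (x := φ (IsLocalRing.closedPoint (integers x.complField))) trivial
  have hU := top_le_preimage hcU
  obtain ⟨g, h, h0, a, hga, rfl⟩ := x.exists_fraction ι hφ U hU ζ
  obtain ⟨J, hJ, hJU⟩ := exists_isFiniteType_ideal_eq U (L := Ideal.span {g, h})
    (Submodule.fg_span (Set.toFinite _))
  have hg : g ∈ J.ideal U := hJU ▸ Ideal.subset_span (by simp)
  have hh : h ∈ J.ideal U := hJU ▸ Ideal.subset_span (by simp)
  refine ⟨_, h0, J, hJ, ?_, ?_⟩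
  · rintro rfl
    refine h0 ?_
    rw [show h = 0 from hh, map_zero]
  · rintro K hK Y φ' σ rfl hinv
    obtain ⟨z, hz⟩ := exists_stalkClosedPointTo_eq φ' σ hinv U hU
      (le_sup_left (a := J.ideal U) hg) (le_sup_left (a := J.ideal U) hh) h0 (by
        intro t ht
        rw [← Ideal.mem_span_singleton, ← Ideal.mem_comap]
        refine (show J.ideal U ⊔ K.ideal U ≤ _ from sup_le ?_ fun t ht ↦ ?_) ht
        · rw [hJU, Ideal.span_le]
          rintro t (rfl | rfl)
          · exact Ideal.mem_span_singleton.mpr ⟨a, hga⟩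
          · exact Ideal.mem_span_singleton_self _
        · exact Ideal.mem_span_singleton.mpr (hK U hU t ht))
    exact ⟨z, congrArg _ (mul_left_cancel₀ h0 (hga.symm.trans hz)).symm⟩

/-- An ideal sheaf whose zero locus does not contain `π(x)` remains nonzero on every scheme to which
the morphism from `Spec ℋ(x)` lifts. -/
theorem AnPoint.comap_ne_bot {J : Z.IdealSheafData} (hpt : ι x.pt ∉ J.support) {T : Scheme.{u}}
    (τ : Spec (.of x.complField) ⟶ T) (σ : T ⟶ Z) (h : τ ≫ σ = x.spec ≫ ι) : J.comap σ ≠ ⊥ := by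
  intro h0
  have h1 : J.comap (x.spec ≫ ι) = ⊤ := comap_eq_top_of_forall_notMem _ _ fun y ↦ by
    rwa [Scheme.Hom.comp_apply, x.spec_apply]
  rw [← h, Scheme.IdealSheafData.comap_comp, h0, Scheme.IdealSheafData.comap_bot] at h1
  exact isInvertible_top.ne_bot h1.symm

/-- An ideal sheaf of finite type whose zero locus does not contain `π(x)` becomes invertible on
`Spec ℋ(x)°`. -/
theorem AnPoint.isInvertible_comap (hφ : specToIntegers x.complField ≫ φ = x.spec ≫ ι)
    {J : Z.IdealSheafData} (hJ : IsFiniteType J)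
    (hpt : ι x.pt ∉ J.support) : IsInvertible (J.comap φ) :=
  have : IsDomain (CommRingCat.of (integers x.complField)) :=
    inferInstanceAs (IsDomain (integers x.complField))
  have : IsBezout (CommRingCat.of (integers x.complField)) :=
    inferInstanceAs (IsBezout (integers x.complField))
  (hJ.comap φ).isInvertible_of_isBezout (x.comap_ne_bot ι hpt _ φ hφ)

end

theorem notMem_support_of_isGenericPoint {X : Scheme.{u}} [IsReduced X] {p : X}
    (hp : IsGenericPoint p (Set.univ : Set X)) {J : X.IdealSheafData} (hJ : J ≠ ⊥) :
    p ∉ J.support := fun h ↦ by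
  obtain ⟨y, hy⟩ := exists_notMem_support hJ
  have : closure {p} ⊆ (J.support : Set X) :=
    closure_minimal (Set.singleton_subset_iff.mpr h) J.support.isClosed
  rw [hp.def] at this
  exact hy (this trivial)

theorem notMem_support_of_comap_eq_top {X Z : Scheme.{u}} (ι : X ⟶ Z) {J : Z.IdealSheafData}
    (hJ : J.comap ι = ⊤) (p : X) : ι p ∉ J.support := fun h ↦ by
  have h1 : p ∈ (J.comap ι).support := by rw [Scheme.IdealSheafData.support_comap]; exact h
  rw [hJ] at h1
  exact h1

namespace B

variable {k : Type u} [NormedField k] [IsUltrametricDist k] {X : Scheme.{u}}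
  {s : X ⟶ Spec (.of k)} {x : AnPoint s}

theorem range_toDouble (b : B x) : Set.range b.toDouble = residueRange b.φ := by
  ext ζ
  constructor
  · rintro ⟨y, rfl⟩
    obtain ⟨z, rfl⟩ := IsLocalRing.residue_surjective y
    exact ⟨z, rfl⟩
  · rintro ⟨z, rfl⟩
    exact ⟨IsLocalRing.residue _ z, rfl⟩

theorem le_iff_residueRange_le {b c : B x} : b ≤ c ↔ residueRange b.φ ≤ residueRange c.φ := by
  rw [← SetLike.coe_subset_coe (S := residueRange b.φ), ← range_toDouble, ← range_toDouble]
  constructor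
  · rintro ⟨i, hi⟩ _ ⟨a, rfl⟩
    exact ⟨i a, congr($hi a)⟩
  · intro h
    let e := RingEquiv.ofBijective c.toDouble.rangeRestrict
      ⟨fun a a' h ↦ c.toDouble.injective (congrArg Subtype.val h),
        c.toDouble.rangeRestrict_surjective⟩
    refine ⟨e.symm.toRingHom.comp (b.toDouble.codRestrict c.toDouble.range fun a ↦ h ⟨a, rfl⟩), ?_⟩
    ext a
    exact congrArg Subtype.val (e.apply_symm_apply ⟨b.toDouble a, h ⟨a, rfl⟩⟩)

theorem le_of_comp_eq {b c : B x} (π : c.scheme ⟶ b.scheme) (h : c.φ ≫ π = b.φ) : b ≤ c := by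
  rw [le_iff_residueRange_le, ← h]
  exact residueRange_comp_le _ _

theorem IsBlowUpOf.le {b c : B x} (h : c.IsBlowUpOf b) : b ≤ c := by
  obtain ⟨π, _, _, _, _, h⟩ := h
  exact le_of_comp_eq π h

end B

/-! ### Blow-ups over a trivially valued field -/

theorem IsInvertible.ne_bot_of_comap {X Y : Scheme.{u}} [Nonempty X] {f : X ⟶ Y}
    {I : Y.IdealSheafData} (h : IsInvertible (I.comap f)) : I ≠ ⊥ := by
  rintro rfl
  exact h.ne_bot (Scheme.IdealSheafData.comap_bot f)

/-- Blowing up the product of two ideal sheaves amounts to blowing up one after the other, provided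
that the exceptional divisor of the first blow-up pulls back to an effective Cartier divisor. -/
theorem IsBlowUp.comp {X Y Y' : Scheme.{u}} {π : Y ⟶ X} {π' : Y' ⟶ Y} {I J : X.IdealSheafData}
    (h : IsBlowUp π I) (h' : IsBlowUp π' (J.comap π)) (hI : IsInvertible ((I.comap π).comap π')) :
    IsBlowUp (π' ≫ π) (I * J) where
  invertible := by
    rw [comap_mul, Scheme.IdealSheafData.comap_comp, Scheme.IdealSheafData.comap_comp]
    exact hI.mul h'.invertible
  universal {T} f hf := by
    rw [comap_mul] at hf
    obtain ⟨g, hg⟩ := h.exists_lift f hf.of_mul_left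
    obtain ⟨g', hg'⟩ := h'.exists_lift g (by
      rw [← Scheme.IdealSheafData.comap_comp, hg]; exact hf.of_mul_right)
    refine ⟨g', by simp only [reassoc_of% hg', hg], fun g'' hg'' ↦ ?_⟩
    have e : g'' ≫ π' = g := by
      refine h.hom_ext ?_ (by rw [Category.assoc, hg'', hg])
      rw [Category.assoc, hg'']; exact hf.of_mul_left
    refine h'.hom_ext ?_ (by rw [e, hg'])
    rw [e, ← Scheme.IdealSheafData.comap_comp, hg]; exact hf.of_mul_right

instance isDominant_specToIntegers (K : Type u) [NormedField K] [IsUltrametricDist K] :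
    IsDominant (specToIntegers K) := by
  refine ⟨(PrimeSpectrum.denseRange_comap_iff_ker_le_nilRadical _).mpr ?_⟩
  have h : RingHom.ker (integers K).subtype = ⊥ :=
    (RingHom.injective_iff_ker_eq_bot _).mp Subtype.val_injective
  exact h.le.trans bot_le

theorem isSeparated_of_isSeparated_hom {X S : Scheme.{u}} [IsAffine S] (f : X ⟶ S)
    [IsSeparated f] : X.IsSeparated :=
  ⟨by rw [← terminal.comp_from f]; infer_instance⟩

namespace B

variable {k : Type u} [NormedField k] [IsUltrametricDist k] {X : Scheme.{u}}
  {s : X ⟶ Spec (.of k)} {x : AnPoint s}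

/-- If `k` is trivially valued, blowing up the inverse image of an ideal sheaf of `X` leads from an
element of `B(X, x)` to another one: the composite is again a blow-up of `X`, and the center persists
because finitely generated ideals of `ℋ(x)°` are principal. -/
theorem exists_isBlowUpOf_blowUp [IsIntegral X] (hx : x.IsValuation) (triv : integers k = ⊤)
    (Y : BlowUp X) (φ : Spec (.of (integers x.complField)) ⟶ Y.scheme)
    (comm : specToIntegers x.complField ≫ φ ≫ Y.proj = x.spec) {J : X.IdealSheafData}
    (hJ : IsFiniteType J) (hJ0 : J ≠ ⊥) :
    ∃ (d : B x) (σ : d.scheme ⟶ X), d.φ ≫ σ = φ ≫ Y.proj ∧ IsInvertible (J.comap σ) ∧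
      d.IsBlowUpOf (.blowUp triv Y φ comm) := by
  have hφ : specToIntegers x.complField ≫ φ ≫ Y.proj = x.spec ≫ 𝟙 X := by
    rw [comm, Category.comp_id]
  have hpt {I : X.IdealSheafData} (hI : I ≠ ⊥) : (𝟙 X : X ⟶ X) x.pt ∉ I.support :=
    notMem_support_of_isGenericPoint hx hI
  have hI0 : J.comap Y.proj ≠ ⊥ :=
    x.comap_ne_bot (𝟙 X) (hpt hJ0) (specToIntegers x.complField ≫ φ) Y.proj
      (by rw [Category.assoc, hφ])
  obtain ⟨Y', π, hπ, -⟩ := exists_isBlowUp (hJ.comap Y.proj)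
  have : IsIntegral Y.scheme := Y.isBlowUp.isIntegral Y.ne_bot
  have : IsIntegral Y' := hπ.isIntegral hI0
  obtain ⟨φ', hφ'⟩ := hπ.exists_lift φ (by
    rw [← Scheme.IdealSheafData.comap_comp]
    exact x.isInvertible_comap (𝟙 X) hφ hJ (hpt hJ0))
  have hY : IsInvertible ((Y.ideal.comap Y.proj).comap π) := by
    refine Y.isBlowUp.invertible.comap_of_ne_bot π ?_
    rw [← Scheme.IdealSheafData.comap_comp]
    refine x.comap_ne_bot (𝟙 X) (hpt Y.ne_bot) (specToIntegers x.complField ≫ φ') _ ?_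
    rw [Category.assoc, reassoc_of% hφ', hφ]
  have hb := Y.isBlowUp.comp hπ hY
  let Y'' : BlowUp X :=
    { scheme := Y'
      proj := π ≫ Y.proj
      ideal := Y.ideal * J
      ne_bot := hb.invertible.ne_bot_of_comap
      isFiniteType := Y.isFiniteType.mul hJ
      isBlowUp := hb }
  refine ⟨.blowUp triv Y'' φ' ?_, π ≫ Y.proj, ?_, ?_, π, J.comap Y.proj, hI0, hJ.comap _, hπ, hφ'⟩
  · change specToIntegers x.complField ≫ φ' ≫ π ≫ Y.proj = x.spec
    rw [reassoc_of% hφ', comm]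
  · change φ' ≫ π ≫ Y.proj = φ ≫ Y.proj
    rw [reassoc_of% hφ']
  · change IsInvertible (J.comap (show Y' ⟶ X from π ≫ Y.proj))
    rw [Scheme.IdealSheafData.comap_comp]
    exact hπ.invertible

theorem exists_mem_range_blowUp (hX : IsVariety s) (hx : x.IsValuation)
    (triv : integers k = ⊤) (Y : BlowUp X) (φ : Spec (.of (integers x.complField)) ⟶ Y.scheme)
    (comm : specToIntegers x.complField ≫ φ ≫ Y.proj = x.spec) (ζ : x.doubleResidueField) :
    ∃ d : B x, ζ ∈ residueRange d.φ := by
  have := hX.isIntegral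
  have := hX.isSeparated
  have := hX.quasiCompact
  have : CompactSpace X := (quasiCompact_iff_compactSpace s).mp inferInstance
  have : QuasiSeparatedSpace X := (quasiSeparated_iff_quasiSeparatedSpace s).mp inferInstance
  obtain ⟨a, -, J, hJ, hJ0, H⟩ := x.exists_ideal_mem_residueRange (𝟙 X) (φ := φ ≫ Y.proj)
    (by rw [comm, Category.comp_id]) ζ
  obtain ⟨d, σ, hσ, hinv, -⟩ := exists_isBlowUpOf_blowUp hx triv Y φ comm hJ hJ0
  refine ⟨d, H ⊥ (fun U hU t ht ↦ ?_) d.φ σ hσ (by rwa [sup_bot_eq])⟩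
  rw [show t = 0 from ht, map_zero]
  exact dvd_zero _

/-- Blowing up the center of the second blow-up yields a scheme which dominates both. -/
theorem exists_isBlowUpOf_blowUp_le (hX : IsVariety s) (hx : x.IsValuation)
    (triv : integers k = ⊤) (Y Y' : BlowUp X)
    (φ : Spec (.of (integers x.complField)) ⟶ Y.scheme)
    (comm : specToIntegers x.complField ≫ φ ≫ Y.proj = x.spec)
    (φ' : Spec (.of (integers x.complField)) ⟶ Y'.scheme)
    (comm' : specToIntegers x.complField ≫ φ' ≫ Y'.proj = x.spec) :
    ∃ d : B x, d.IsBlowUpOf (.blowUp triv Y φ comm) ∧ .blowUp triv Y' φ' comm' ≤ d := by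
  have := hX.isIntegral
  have := hX.isSeparated
  have := isSeparated_of_isSeparated_hom s
  obtain ⟨d, σ, hσ, hinv, hd⟩ :=
    exists_isBlowUpOf_blowUp hx triv Y φ comm Y'.isFiniteType Y'.ne_bot
  obtain ⟨τ, hτ⟩ := Y'.isBlowUp.exists_lift σ hinv
  have e : φ ≫ Y.proj = φ' ≫ Y'.proj :=
    ext_of_isDominant (specToIntegers x.complField) (comm.trans comm'.symm)
  have e' : (d.φ ≫ τ) ≫ Y'.proj = φ ≫ Y.proj := by rw [Category.assoc, hτ, hσ]
  refine ⟨d, hd, le_of_comp_eq (b := .blowUp triv Y' φ' comm') τ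
    (show d.φ ≫ τ = φ' from Y'.isBlowUp.hom_ext ?_ (e'.trans e))⟩
  rw [e']
  exact x.isInvertible_comap (𝟙 X) (by rw [comm, Category.comp_id]) Y'.isFiniteType
    (notMem_support_of_isGenericPoint hx Y'.ne_bot)

end B

/-! ### Blow-ups of models -/

/-- A dominant morphism from an integral scheme to the spectrum of a Bézout domain is flat, because
flat and torsion-free are the same there. -/
theorem flat_of_isDominant {O : CommRingCat.{u}} [IsDomain O] [IsBezout O] {Y : Scheme.{u}}
    [IsIntegral Y] (f : Y ⟶ Spec O) [IsDominant f] : Flat f := by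
  have : IsBezout Γ(Spec O, ⊤) :=
    Function.Surjective.isBezout (Scheme.ΓSpecIso O).symm.commRingCatIsoToRingEquiv.toRingHom
      (Scheme.ΓSpecIso O).symm.commRingCatIsoToRingEquiv.surjective
  refine HasRingHomProperty.of_iSup_eq_top (P := @Flat) (fun U : Y.affineOpens ↦ U)
    (iSup_affineOpens_eq_top Y) fun U ↦ ?_
  let _ := (f.appLE ⊤ U.1 le_top).hom.toAlgebra
  change Module.Flat Γ(Spec O, ⊤) Γ(Y, U.1)
  rw [Module.Flat.flat_iff_torsion_eq_bot_of_isBezout]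
  obtain hU | ⟨⟨y, hy⟩⟩ := isEmpty_or_nonempty U.1
  · have : U.1 = ⊥ := by ext x; simpa using fun hx ↦ hU.false ⟨x, hx⟩
    have : Subsingleton Γ(Y, U.1) := by rw [this]; infer_instance
    exact Subsingleton.elim _ _
  have : Nonempty U.1 := ⟨⟨y, hy⟩⟩
  rw [← Submodule.isTorsionFree_iff_torsion_eq_bot]
  have hinj : Function.Injective (algebraMap Γ(Spec O, ⊤) Γ(Y, U.1)) := by
    rw [injective_iff_map_eq_zero]
    intro a ha
    by_contra ha0
    have hD : ((Spec O).basicOpen a : Set (Spec O)).Nonempty :=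
      (Opens.ne_bot_iff_nonempty _).mp (mt (basicOpen_eq_bot_iff a).mp ha0)
    obtain ⟨z, hz⟩ := f.denseRange.exists_mem_open ((Spec O).basicOpen a).isOpen hD
    obtain ⟨w, hwU, hw⟩ := nonempty_preirreducible_inter U.1.isOpen
      (f ⁻¹ᵁ (Spec O).basicOpen a).isOpen ⟨y, hy⟩ ⟨z, hz⟩
    have h1 : w ∈ Y.basicOpen ((f.appLE ⊤ U.1 le_top).hom a) :=
      (Scheme.basicOpen_appLE f _ _ _ a).ge ⟨hwU, hw⟩
    rw [show (f.appLE ⊤ U.1 le_top).hom a = 0 from ha, Scheme.basicOpen_zero] at h1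
    exact h1
  exact Module.isTorsionFree_iff_algebraMap_injective.mpr hinj

theorem exists_norm_lt {k : Type u} [NormedField k] [IsUltrametricDist k] (h : integers k ≠ ⊤)
    {r : ℝ} (hr : 0 < r) : ∃ ϖ : integers k, ϖ ≠ 0 ∧ ‖(ϖ : k)‖ < r ∧ ‖(ϖ : k)‖ < 1 := by
  obtain ⟨a, ha⟩ : ∃ a : k, a ∉ integers k := by
    by_contra! h'
    exact h (eq_top_iff.mpr fun a _ ↦ h' a)
  rw [mem_integers_iff, not_le] at ha
  have ha1 : ‖a⁻¹‖ < 1 := by rw [norm_inv]; exact inv_lt_one_of_one_lt₀ ha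
  obtain ⟨n, hn⟩ := exists_pow_lt_of_lt_one (lt_min hr one_pos) ha1
  rw [← norm_pow, lt_min_iff] at hn
  refine ⟨⟨a⁻¹ ^ n, mem_integers_iff.mpr hn.2.le⟩, fun h0 ↦ ?_, hn⟩
  have h1 : a⁻¹ ^ n = 0 := congrArg Subtype.val h0
  have : a = 0 := by simpa using eq_zero_of_pow_eq_zero h1
  rw [this, norm_zero] at ha
  exact absurd ha (by norm_num)

/-- If `k` is not trivially valued, the generic point of `Spec k°` is open. -/
theorem isOpenImmersion_specToIntegers {k : Type u} [NormedField k] [IsUltrametricDist k]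
    (h : integers k ≠ ⊤) : IsOpenImmersion (specToIntegers k) := by
  obtain ⟨ϖ, h0, -, h1⟩ := exists_norm_lt h one_pos
  have h0' : (ϖ : k) ≠ 0 := by simpa using h0
  have : IsLocalization.Away ϖ k := by
    refine IsLocalization.Away.mk ϖ (isUnit_iff_ne_zero.mpr h0') (fun a ↦ ?_)
      fun a b h ↦ ⟨0, by rw [Subtype.ext h]⟩
    obtain ⟨n, hn⟩ := exists_pow_lt_of_lt_one (x := (‖a‖ + 1)⁻¹) (by positivity) h1
    refine ⟨n, ⟨a * ϖ ^ n, mem_integers_iff.mpr ?_⟩, rfl⟩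
    rw [norm_mul, norm_pow]
    calc ‖a‖ * ‖(ϖ : k)‖ ^ n ≤ (‖a‖ + 1) * (‖a‖ + 1)⁻¹ := by gcongr; linarith
      _ = 1 := mul_inv_cancel₀ (by positivity)
  exact IsOpenImmersion.of_isLocalization ϖ

theorem Model.isOpenImmersion_incl {k : Type u} [NormedField k] [IsUltrametricDist k]
    {X : Scheme.{u}} {s : X ⟶ Spec (.of k)} (M : Model s) (h : integers k ≠ ⊤) :
    IsOpenImmersion M.incl :=
  have := isOpenImmersion_specToIntegers h
  MorphismProperty.of_isPullback (P := @IsOpenImmersion) M.isPullback.flip inferInstance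

theorem isDominant_of_field {k : Type u} [Field k] {X : Scheme.{u}} [Nonempty X]
    (s : X ⟶ Spec (.of k)) : IsDominant s :=
  ⟨fun _ ↦ subset_closure ⟨Classical.arbitrary X, Subsingleton.elim (α := PrimeSpectrum k) _ _⟩⟩

namespace B

variable {k : Type u} [NormedField k] [IsUltrametricDist k] {X : Scheme.{u}}
  {s : X ⟶ Spec (.of k)} {x : AnPoint s}

/-- Blowing up an ideal sheaf of a model which is trivial on the generic fibre leads from an element
of `B(X, x)` to another one. -/
theorem exists_isBlowUpOf_model (hX : IsVariety s) (nontriv : integers k ≠ ⊤) (M : Model s)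
    (φ : Spec (.of (integers x.complField)) ⟶ M.scheme)
    (comm : specToIntegers x.complField ≫ φ = x.spec ≫ M.incl) {J : M.scheme.IdealSheafData}
    (hJ : IsFiniteType J) (hJtop : J.comap M.incl = ⊤) :
    ∃ (d : B x) (σ : d.scheme ⟶ M.scheme), d.φ ≫ σ = φ ∧ IsInvertible (J.comap σ) ∧
      d.IsBlowUpOf (.model nontriv M φ comm) := by
  have := hX.isIntegral
  have := M.isIntegral
  have := M.isSeparated
  have := M.locallyOfFiniteType
  have := M.quasiCompact
  have := M.isOpenImmersion_incl nontriv
  have hinv : IsInvertible (J.comap M.incl) := hJtop ▸ isInvertible_top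
  have hJ0 : J ≠ ⊥ := hinv.ne_bot_of_comap
  obtain ⟨Y, π, hπ, _, _, _⟩ := exists_isBlowUp hJ
  have : IsIntegral Y := hπ.isIntegral hJ0
  obtain ⟨i, hi⟩ := hπ.exists_lift M.incl hinv
  -- nothing happens over the generic fibre
  have hpb : IsPullback i (𝟙 X) π M.incl :=
    hπ.isPullback (hJtop ▸ isBlowUp_id_top) (by rw [hi, Category.id_comp])
  have hpb' := hpb.paste_vert M.isPullback
  rw [Category.id_comp] at hpb'
  have : IsDominant (i ≫ π ≫ M.str) := by
    rw [hpb'.w]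
    have := isDominant_of_field s
    infer_instance
  have : IsDominant (π ≫ M.str) := IsDominant.of_comp i _
  have : IsDomain (CommRingCat.of (integers k)) := inferInstanceAs (IsDomain (integers k))
  have : IsBezout (CommRingCat.of (integers k)) := inferInstanceAs (IsBezout (integers k))
  obtain ⟨φ', hφ'⟩ := hπ.exists_lift φ
    (x.isInvertible_comap M.incl comm hJ (notMem_support_of_comap_eq_top _ hJtop _))
  let M' : Model s :=
    { scheme := Y
      str := π ≫ M.str
      incl := i
      isPullback := hpb'
      isIntegral := inferInstance
      flat := flat_of_isDominant _
      isSeparated := inferInstance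
      locallyOfFiniteType := inferInstance
      quasiCompact := inferInstance }
  have comm' : specToIntegers x.complField ≫ φ' = x.spec ≫ i := by
    have e : (specToIntegers x.complField ≫ φ') ≫ π = x.spec ≫ M.incl := by
      rw [Category.assoc, hφ', comm]
    refine hπ.hom_ext ?_ (by rw [e, Category.assoc, hi])
    rw [e, Scheme.IdealSheafData.comap_comp, hJtop, Scheme.IdealSheafData.comap_top]
    exact isInvertible_top
  exact ⟨.model nontriv M' φ' comm', π, hφ', hπ.invertible, π, J, hJ0, hJ, hπ, hφ'⟩

end B

/-! ### Ideal sheaves of models that realize given residues -/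

/-- The values of the sections of `I` lie in the ideal of `R` which defines the inverse image
of `I`. -/
theorem evalOn_mem {R : Type u} [CommRing R] {Y : Scheme.{u}} (φ : Spec (.of R) ⟶ Y)
    {I : Y.IdealSheafData} {L : Ideal R} (h : I.comap φ = specIdeal L) (U : Y.affineOpens)
    (hU : ⊤ ≤ φ ⁻¹ᵁ U.1) {t : Γ(Y, U.1)} (ht : t ∈ I.ideal U) : evalOn φ U.1 hU t ∈ L := by
  have h1 := Ideal.mem_map_of_mem (φ.appLE U.1 ⊤ hU).hom ht
  have h2 := ideal_comap φ I U ⟨⊤, isAffineOpen_top _⟩ hU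
  rw [h, specIdeal_ideal_top] at h2
  have h3 := Ideal.mem_map_of_mem (Scheme.ΓSpecIso (.of R)).hom.hom (h2 ▸ h1)
  rw [Ideal.map_map, ← CommRingCat.hom_comp, Iso.inv_hom_id, CommRingCat.hom_id, Ideal.map_id] at h3
  exact h3

theorem residue_evalOn_mem_residueRange {R : Type u} [CommRing R] [IsLocalRing R] {Y : Scheme.{u}}
    (φ : Spec (.of R) ⟶ Y) (U : Y.Opens) (hU : ⊤ ≤ φ ⁻¹ᵁ U) (t : Γ(Y, U)) :
    IsLocalRing.residue R (evalOn φ U hU t) ∈ residueRange φ := by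
  have hc : φ (IsLocalRing.closedPoint R) ∈ U := hU (x := IsLocalRing.closedPoint R) trivial
  refine ⟨(Y.presheaf.germ U _ hc).hom t, ?_⟩
  rw [RingHom.comp_apply, stalkClosedPointTo_germ]

/-- The image of the local ring is closed under division, because local homomorphisms reflect
units. -/
theorem mem_residueRange_of_mul_mem {R : Type u} [CommRing R] [IsLocalRing R] {Y : Scheme.{u}}
    {φ : Spec (.of R) ⟶ Y} {a b : IsLocalRing.ResidueField R} (hb0 : b ≠ 0)
    (hb : b ∈ residueRange φ) (hab : a * b ∈ residueRange φ) : a ∈ residueRange φ := by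
  obtain ⟨z, rfl⟩ := hb
  have hz : IsUnit z := by
    refine isUnit_of_map_unit (Scheme.stalkClosedPointTo φ).hom _ ?_
    exact isUnit_of_map_unit (IsLocalRing.residue R) _ (isUnit_iff_ne_zero.mpr hb0)
  obtain ⟨w, hw⟩ := hz.exists_right_inv
  have := mul_mem hab ⟨w, rfl⟩
  rwa [mul_assoc, ← map_mul, hw, map_one, mul_one] at this

/-- The image of the local ring is contained in a given image as soon as this holds for the sections
over one affine neighbourhood. -/
theorem residueRange_le_of_forall {R : Type u} [CommRing R] [IsLocalRing R] {Y Y' : Scheme.{u}}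
    {φ : Spec (.of R) ⟶ Y} {φ' : Spec (.of R) ⟶ Y'} (U : Y.affineOpens) (hU : ⊤ ≤ φ ⁻¹ᵁ U.1)
    (h : ∀ t, IsLocalRing.residue R (evalOn φ U.1 hU t) ∈ residueRange φ') :
    residueRange φ ≤ residueRange φ' := by
  rintro _ ⟨z, rfl⟩
  have hc : φ (IsLocalRing.closedPoint R) ∈ U.1 := hU (x := IsLocalRing.closedPoint R) trivial
  let _ := Y.presheaf.algebra_section_stalk ⟨_, hc⟩
  have := U.2.isLocalization_stalk ⟨_, hc⟩
  obtain ⟨⟨g, h'⟩, e⟩ := IsLocalization.surj (U.2.primeIdealOf ⟨_, hc⟩).asIdeal.primeCompl z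
  have e' := congrArg ((IsLocalRing.residue R).comp (Scheme.stalkClosedPointTo φ).hom) e
  have hu := (IsLocalization.map_units (Y.presheaf.stalk _) h').map
    ((IsLocalRing.residue R).comp (Scheme.stalkClosedPointTo φ).hom)
  have hev (t : Γ(Y, U.1)) : ((IsLocalRing.residue R).comp (Scheme.stalkClosedPointTo φ).hom)
      (algebraMap Γ(Y, U.1) (Y.presheaf.stalk (φ (IsLocalRing.closedPoint R))) t) =
        IsLocalRing.residue R (evalOn φ U.1 hU t) := by
    rw [← stalkClosedPointTo_germ φ U.1 hc]
    rfl
  rw [hev] at hu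
  refine mem_residueRange_of_mul_mem hu.ne_zero (h _) ?_
  rw [map_mul, hev, hev] at e'
  rw [e']
  exact h g

theorem AnPoint.norm_toComplField_toResidueField {k : Type u} [NormedField k] {X : Scheme.{u}}
    {s : X ⟶ Spec (.of k)} (x : AnPoint s) (a : k) :
    ‖x.toComplField (toResidueField s x.pt a)‖ = ‖a‖ :=
  (x.norm_toComplField _).trans (x.extends_norm a)

section

variable {k : Type u} [NormedField k] [IsUltrametricDist k] {X : Scheme.{u}}
  {s : X ⟶ Spec (.of k)} (x : AnPoint s)

/-- The inclusion `k° → ℋ(x)°`. -/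
def AnPoint.integersMap : integers k →+* integers x.complField :=
  ((x.toComplField.comp (toResidueField s x.pt)).comp (integers k).subtype).codRestrict
    (integers x.complField) fun a ↦ mem_integers_iff.mpr
      ((x.norm_toComplField_toResidueField a).trans_le (norm_coe_le_one a))

theorem AnPoint.norm_integersMap (a : integers k) :
    ‖(x.integersMap a : x.complField)‖ = ‖(a : k)‖ :=
  x.norm_toComplField_toResidueField a

/-- The extension of `Spec ℋ(x) ⟶ X ⟶ 𝒳` to `Spec ℋ(x)°` is a morphism over `Spec k°`. -/
theorem AnPoint.comp_str_eq (M : Model s) {φ : Spec (.of (integers x.complField)) ⟶ M.scheme}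
    (comm : specToIntegers x.complField ≫ φ = x.spec ≫ M.incl) :
    φ ≫ M.str = Spec.map (CommRingCat.ofHom x.integersMap) := by
  refine ext_of_isDominant (specToIntegers x.complField) ?_
  have e : x.spec ≫ s = Spec.map (CommRingCat.ofHom
      (x.toComplField.comp (toResidueField s x.pt))) := by
    rw [CommRingCat.ofHom_comp, Spec.map_comp, AnPoint.spec, Category.assoc, toResidueField,
      CommRingCat.ofHom_hom, Spec.map_preimage]
  rw [reassoc_of% comm, M.isPullback.w, reassoc_of% e, specToIntegers, specToIntegers,
    ← Spec.map_comp, ← Spec.map_comp]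
  rfl

theorem specIdeal_top {A : Type u} [CommRing A] : specIdeal (⊤ : Ideal A) = ⊤ := by
  refine Scheme.IdealSheafData.ext_of_isAffine ?_
  rw [specIdeal_ideal_top, Ideal.map_top]
  rfl

/-- The ideal sheaf of a model that is generated by a constant `ϖ ≠ 0` does not meet the generic
fibre, and it consists of multiples of each `a ∈ ℋ(x)°` with `|ϖ| ≤ |a|`. -/
theorem AnPoint.exists_constant_ideal (nontriv : integers k ≠ ⊤) (M : Model s)
    {φ : Spec (.of (integers x.complField)) ⟶ M.scheme}
    (comm : specToIntegers x.complField ≫ φ = x.spec ≫ M.incl) {a : integers x.complField}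
    (ha : a ≠ 0) : ∃ K : M.scheme.IdealSheafData, IsFiniteType K ∧ K.comap M.incl = ⊤ ∧
      ∀ (U : M.scheme.affineOpens) (hU : ⊤ ≤ φ ⁻¹ᵁ U.1), ∀ t ∈ K.ideal U,
        a ∣ evalOn φ U.1 hU t := by
  obtain ⟨ϖ, h0, h1, -⟩ := exists_norm_lt nontriv (r := ‖(a : x.complField)‖)
    (norm_pos_iff.mpr (by simpa using ha))
  refine ⟨(specIdeal (Ideal.span {ϖ})).comap M.str, ?_, ?_, fun U hU t ht ↦ ?_⟩
  · refine IsFiniteType.comap (isFiniteType_of_forall_exists fun y ↦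
      ⟨⟨⊤, isAffineOpen_top _⟩, trivial, ?_⟩) _
    rw [specIdeal_ideal_top]
    exact Ideal.FG.map (Submodule.fg_span_singleton ϖ) _
  · rw [← Scheme.IdealSheafData.comap_comp, M.isPullback.w, Scheme.IdealSheafData.comap_comp,
      comap_specIdeal, Ideal.map_span, Set.image_singleton,
      Ideal.span_singleton_eq_top.mpr (isUnit_iff_ne_zero.mpr (by simpa using h0)),
      specIdeal_top, Scheme.IdealSheafData.comap_top]
  · have h2 := evalOn_mem φ (L := Ideal.span {x.integersMap ϖ}) (by
      rw [← Scheme.IdealSheafData.comap_comp, x.comp_str_eq M comm, comap_specIdeal,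
        Ideal.map_span, Set.image_singleton]) U hU ht
    refine dvd_trans (dvd_of_norm_le ?_) (Ideal.mem_span_singleton.mp h2)
    rw [x.norm_integersMap]
    exact h1.le

end

namespace B

variable {k : Type u} [NormedField k] [IsUltrametricDist k] {X : Scheme.{u}}
  {s : X ⟶ Spec (.of k)} {x : AnPoint s}

/-- Finitely many elements of the double residue field are reached by one blow-up of a model in the
special fibre: for each of them an ideal generated by a numerator and a denominator is made trivial
on the generic fibre by adding a small constant, and the product of these ideals is blown up. -/
theorem exists_ideal_subset_residueRange (nontriv : integers k ≠ ⊤) (M : Model s)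
    {φ : Spec (.of (integers x.complField)) ⟶ M.scheme}
    (comm : specToIntegers x.complField ≫ φ = x.spec ≫ M.incl) (S : Finset x.doubleResidueField) :
    ∃ J : M.scheme.IdealSheafData, IsFiniteType J ∧ J.comap M.incl = ⊤ ∧
      ∀ {Y : Scheme.{u}} (φ' : Spec (.of (integers x.complField)) ⟶ Y) (σ : Y ⟶ M.scheme),
        φ' ≫ σ = φ → IsInvertible (J.comap σ) → ∀ ζ ∈ S, ζ ∈ residueRange φ' := by
  classical
  have := M.isSeparated
  have := M.quasiCompact
  have := M.isOpenImmersion_incl nontriv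
  have : CompactSpace M.scheme := (quasiCompact_iff_compactSpace M.str).mp inferInstance
  have : QuasiSeparatedSpace M.scheme :=
    (quasiSeparated_iff_quasiSeparatedSpace M.str).mp inferInstance
  induction S using Finset.induction_on with
  | empty => exact ⟨⊤, fun U ↦ ⟨{1}, by simp⟩, Scheme.IdealSheafData.comap_top _, by simp⟩
  | insert ζ S hζ ih =>
    obtain ⟨J, hJ, hJtop, H⟩ := ih
    obtain ⟨a, ha, I, hI, -, H'⟩ := x.exists_ideal_mem_residueRange M.incl comm ζ
    obtain ⟨K, hK, hKtop, hKa⟩ := x.exists_constant_ideal nontriv M comm ha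
    refine ⟨(I ⊔ K) * J, (hI.sup hK).mul hJ, ?_, fun φ' σ hσ hinv ξ hξ ↦ ?_⟩
    · rw [comap_mul, hJtop, Scheme.IdealSheafData.comap_sup, hKtop, sup_top_eq]
      ext; simp
    · rw [comap_mul] at hinv
      rcases Finset.mem_insert.mp hξ with rfl | hξ
      · exact H' K hKa φ' σ hσ hinv.of_mul_left
      · exact H φ' σ hσ hinv.of_mul_right ξ hξ

end B

/-! ### The system of centers is directed -/

/-- Let `f : Y ⟶ Spec A` be of finite type and `φ : Spec R ⟶ Y`. Finitely many elements of the
residue field of `R`, together with the image of `A`, generate a subring whose fractions exhaust the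
residue field of the center of `φ`. -/
theorem exists_finset_residueRange_le {A R : Type u} [CommRing A] [CommRing R] [IsLocalRing R]
    {Y : Scheme.{u}} (f : Y ⟶ Spec (.of A)) [LocallyOfFiniteType f] (φ : Spec (.of R) ⟶ Y)
    {ρ : A →+* R} (hφ : φ ≫ f = Spec.map (CommRingCat.ofHom ρ)) :
    ∃ S : Finset (IsLocalRing.ResidueField R), ∀ {Y' : Scheme.{u}} (φ' : Spec (.of R) ⟶ Y')
      (f' : Y' ⟶ Spec (.of A)), φ' ≫ f' = Spec.map (CommRingCat.ofHom ρ) →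
        (∀ ζ ∈ S, ζ ∈ residueRange φ') → residueRange φ ≤ residueRange φ' := by
  classical
  obtain ⟨U, hU, hc, -⟩ := exists_isAffineOpen_mem_and_subset
    (x := φ (IsLocalRing.closedPoint R)) (U := ⊤) trivial
  have hU' := top_le_preimage hc
  have hft : (f.appLE ⊤ U le_top).hom.FiniteType :=
    HasRingHomProperty.appLE @LocallyOfFiniteType f inferInstance ⟨⊤, isAffineOpen_top _⟩ ⟨U, hU⟩
      le_top
  let _ := (f.appLE ⊤ U le_top).hom.toAlgebra
  obtain ⟨T, hT⟩ : (⊤ : Subalgebra Γ(Spec (.of A), ⊤) Γ(Y, U)).FG := hft.out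
  refine ⟨T.image fun t ↦ IsLocalRing.residue R (evalOn φ U hU' t), fun φ' f' hφ' h ↦ ?_⟩
  refine residueRange_le_of_forall ⟨U, hU⟩ hU' fun t ↦ ?_
  have ht : t ∈ Algebra.adjoin Γ(Spec (.of A), ⊤) (T : Set Γ(Y, U)) := hT ▸ trivial
  induction ht using Algebra.adjoin_induction with
  | mem t ht => exact h _ (Finset.mem_image_of_mem _ ht)
  | algebraMap b =>
    have h1 : evalOn φ U hU' ((f.appLE ⊤ U le_top).hom b) =
        ρ ((Scheme.ΓSpecIso (.of A)).hom.hom b) := by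
      rw [evalOn_comp φ f ⊤ U le_top hU' le_top]
      simp only [hφ, evalOn_specMap_top]
    have h2 : evalOn (φ' ≫ f') ⊤ le_top b = ρ ((Scheme.ΓSpecIso (.of A)).hom.hom b) := by
      simp only [hφ', evalOn_specMap_top]
    refine residueRange_comp_le φ' f' ?_
    have h3 := residue_evalOn_mem_residueRange (φ' ≫ f') ⊤ le_top b
    rw [h2, ← h1] at h3
    exact h3
  | add t t' _ _ ht ht' => rw [map_add, map_add]; exact add_mem ht ht'
  | mul t t' _ _ ht ht' => rw [map_mul, map_mul]; exact mul_mem ht ht'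

namespace B

variable {k : Type u} [NormedField k] [IsUltrametricDist k] {X : Scheme.{u}}
  {s : X ⟶ Spec (.of k)} {x : AnPoint s}

theorem exists_mem_range_model (hX : IsVariety s) (nontriv : integers k ≠ ⊤) (M : Model s)
    (φ : Spec (.of (integers x.complField)) ⟶ M.scheme)
    (comm : specToIntegers x.complField ≫ φ = x.spec ≫ M.incl) (ζ : x.doubleResidueField) :
    ∃ d : B x, ζ ∈ residueRange d.φ := by
  obtain ⟨J, hJ, hJtop, H⟩ := exists_ideal_subset_residueRange nontriv M comm {ζ}
  obtain ⟨d, σ, hσ, hinv, -⟩ := exists_isBlowUpOf_model hX nontriv M φ comm hJ hJtop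
  exact ⟨d, H d.φ σ hσ hinv ζ (Finset.mem_singleton_self ζ)⟩

/-- The residue field of the center in the second model is finitely generated over that of its image
in `Spec k°`, so that it is reached by one blow-up of the first model. -/
theorem exists_isBlowUpOf_model_le (hX : IsVariety s) (nontriv : integers k ≠ ⊤) (M M' : Model s)
    (φ : Spec (.of (integers x.complField)) ⟶ M.scheme)
    (comm : specToIntegers x.complField ≫ φ = x.spec ≫ M.incl)
    (φ' : Spec (.of (integers x.complField)) ⟶ M'.scheme)
    (comm' : specToIntegers x.complField ≫ φ' = x.spec ≫ M'.incl) :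
    ∃ d : B x, d.IsBlowUpOf (.model nontriv M φ comm) ∧ .model nontriv M' φ' comm' ≤ d := by
  have := M'.locallyOfFiniteType
  obtain ⟨S, hS⟩ := exists_finset_residueRange_le M'.str φ' (x.comp_str_eq M' comm')
  obtain ⟨J, hJ, hJtop, H⟩ := exists_ideal_subset_residueRange nontriv M comm S
  obtain ⟨d, σ, hσ, hinv, hd⟩ := exists_isBlowUpOf_model hX nontriv M φ comm hJ hJtop
  refine ⟨d, hd, le_iff_residueRange_le.mpr (hS d.φ (σ ≫ M.str) ?_ (H d.φ σ hσ hinv))⟩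
  rw [reassoc_of% hσ, x.comp_str_eq M comm]

theorem exists_mem_range (hX : IsVariety s) (hx : x.IsValuation) (b : B x)
    (ζ : x.doubleResidueField) : ∃ d : B x, ζ ∈ Set.range d.toDouble := by
  simp only [range_toDouble]
  cases b with
  | blowUp triv Y φ comm => exact exists_mem_range_blowUp hX hx triv Y φ comm ζ
  | model nontriv M φ comm => exact exists_mem_range_model hX nontriv M φ comm ζ

theorem exists_isBlowUpOf_le (hX : IsVariety s) (hx : x.IsValuation) (b c : B x) :
    ∃ d : B x, d.IsBlowUpOf b ∧ c ≤ d := by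
  cases b with
  | blowUp triv Y φ comm =>
    cases c with
    | blowUp _ Y' φ' comm' => exact exists_isBlowUpOf_blowUp_le hX hx triv Y Y' φ comm φ' comm'
    | model nontriv => exact absurd triv nontriv
  | model nontriv M φ comm =>
    cases c with
    | blowUp triv => exact absurd triv nontriv
    | model _ M' φ' comm' => exact exists_isBlowUpOf_model_le hX nontriv M M' φ comm φ' comm'

end B

end BerkovichCenter

end

open BerkovichCenter in
theorem theorem3p5 {k : Type u} [NormedField k] [IsUltrametricDist k] [CompleteSpace k]
    {X : Scheme.{u}} (s : X ⟶ Spec (.of k)) (hX : IsVariety s)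
    (x : AnPoint s) (hx : x.IsValuation) (hB : Nonempty (B x)) :
    -- the double residue field is the union of the residue fields of the centers
    (⋃ b : B x, Set.range b.toDouble) = Set.univ ∧
    -- `B(X, x)` is directed, by means of blow-ups
    (∀ b c : B x, ∃ d : B x, d.IsBlowUpOf b ∧ b ≤ d ∧ c ≤ d) ∧
    -- the double residue field is the direct limit of the residue fields of the centers
    Function.Bijective (B.fromLimit x) := by
  have h1 (ζ : x.doubleResidueField) : ∃ d : B x, ζ ∈ Set.range d.toDouble :=
    hB.elim fun b ↦ B.exists_mem_range hX hx b ζ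
  have h2 (b c : B x) : ∃ d : B x, d.IsBlowUpOf b ∧ b ≤ d ∧ c ≤ d :=
    let ⟨d, hb, hc⟩ := B.exists_isBlowUpOf_le hX hx b c
    ⟨d, hb, hb.le, hc⟩
  refine ⟨Set.iUnion_eq_univ_iff.mpr h1, h2, ?_, fun ζ ↦ ?_⟩
  · have : IsDirectedOrder (B x) := ⟨fun b c ↦ let ⟨d, _, h⟩ := h2 b c; ⟨d, h⟩⟩
    exact Ring.DirectLimit.lift_injective _ _ _ fun b ↦ b.toDouble.injective
  · obtain ⟨d, a, rfl⟩ := h1 ζ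
    exact ⟨Ring.DirectLimit.of _ _ d a, Ring.DirectLimit.lift_of _ _ _ d a⟩
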